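/- Permutations are regarded as finite words; $S_n$ is the set of permutations of length $n\ge 0$. The \emph{pattern} of a finite sequence of distinct numbers is the permutation whose entries are in the same relative order; $\sigma$ is \emph{involved} in $\pi$ if $\sigma$ is the pattern of some subsequence of $\pi$. A \emph{pattern avoidance class} is a set of the form $\mathrm{Av}(X)$, the set of all permutations (including the empty one) in which no $\sigma\in X$ is involved, where $X$ is a set of permutations of length at least $1$. For a class $\mathcal A$ let $L_{\mathcal A}(\pi)$ be the maximum length of a subsequence of $\pi$ whose pattern lies in $\mathcal A$, let $\Pi_n$ be uniformly distributed on $S_n$, and define $s_{\mathcal A}$ and $c_{\mathcal A}\ge 0$ by $$ s_{\mathcal A}=\limsup_{n\to\infty}|S_n\cap\mathcal A|^{1/n},\qquad 2\sqrt{c_{\mathcal A}}=\limsup_{n\to\infty}\frac{\mathbf E\,L_{\mathcal A}(\Pi_n)}{\sqrt n}. $$ Say that $\mathcal A$ \emph{satisfies the conjecture} if both limits superior are in fact (finite) limits and $c_{\mathcal A}=s_{\mathcal A}$. For classes $\mathcal A,\mathcal B$ put $\mathcal A\oplus\mathcal B=\{\alpha\oplus\beta:\alpha\in\mathcal A,\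 \beta\in\mathcal B\}$, where $\alpha\oplus\beta$ is the word $\alpha$ followed by $\beta$ with all entries of $\beta$ shifted above those of $\alpha$; let $\mathrm{Juxt}(\mathcal A,\mathcal B)$ be the set of all permutations that are a concatenation of two (possibly empty) words, the first with pattern in $\mathcal A$ and the second with pattern in $\mathcal B$; and let $\mathrm{Merge}(\mathcal A,\mathcal B)$ be the set of all permutations whose set of positions has a subset $I$ such that the entries at positions in $I$ have pattern in $\mathcal A$ and the remaining entries have pattern in $\mathcal B$. \textbf{Proposition.} Let $\mathcal A$ and $\mathcal B$ be pattern avoidance classes that satisfy the conjecture. 1. $\mathcal U=\mathcal A\cup\mathcal B$ is a pattern avoidance class that satisfies the conjecture, with $c_{\mathcal U}=\max(c_{\mathcal A},c_{\mathcal B})$ and $s_{\mathcal U}=\max(s_{\mathcal A},s_{\mathcal B})$. 2. $\mathcal D=\mathcal A\oplus\mathcal B$ is a pattern avoidance class that satisfies the conjecture, with $c_{\mathcal D}=\max(c_{\mathcal A},c_{\mathcal B})$ and $s_{\mathcal D}=\max(s_{\mathcal A},s_{\mathcal B})$. 3. $\mathcal J=\mathrm{Juxt}(\mathcal A,\mathcal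 B)$ is a pattern avoidance class that satisfies the conjecture, with $c_{\mathcal J}=c_{\mathcal A}+c_{\mathcal B}$ and $s_{\mathcal J}=s_{\mathcal A}+s_{\mathcal B}$. 4. If $\mathcal A\cap\mathcal B$ is finite, then $\mathcal M=\mathrm{Merge}(\mathcal A,\mathcal B)$ is a pattern avoidance class that satisfies the conjecture, with $\sqrt{c_{\mathcal M}}=\sqrt{c_{\mathcal A}}+\sqrt{c_{\mathcal B}}$ and $\sqrt{s_{\mathcal M}}=\sqrt{s_{\mathcal A}}+\sqrt{s_{\mathcal B}}$. -/

import Mathlib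

open Filter Topology

namespace PermClass

/-- A permutation of some finite length `n ≥ 0`, with entries and positions in `Fin n`;
`⟨n, π⟩` is the word `π 0, π 1, …, π (n - 1)`. -/
abbrev FinPerm : Type := Σ n : ℕ, Equiv.Perm (Fin n)

/-- The pattern of a finite sequence of distinct values of a linear order: the permutation whose
entries are in the same relative order as those of the sequence (see `patternOf_lt_iff`). -/
def patternOf {α : Type*} [LinearOrder α] {k : ℕ} (f : Fin k → α) : Equiv.Perm (Fin k) :=
  (Tuple.sort f)⁻¹

theorem patternOf_lt_iff {α : Type*} [LinearOrder α] {k : ℕ} {f : Fin k → α}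
    (hf : Function.Injective f) (i j : Fin k) :
    patternOf f i < patternOf f j ↔ f i < f j := by
  have hm : StrictMono (f ∘ Tuple.sort f) :=
    (Tuple.monotone_sort f).strictMono_of_injective (hf.comp (Tuple.sort f).injective)
  have h := hm.lt_iff_lt (a := patternOf f i) (b := patternOf f j)
  simpa [patternOf] using h.symm

/-- `σ` is involved in `π`: some subsequence of `π` is in the same relative order as `σ`. -/
def Involved (σ π : FinPerm) : Prop :=
  ∃ g : Fin σ.1 → Fin π.1, StrictMono g ∧
    ∀ s t : Fin σ.1, σ.2 s < σ.2 t ↔ π.2 (g s) < π.2 (g t)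

/-- `Av B`: all permutations that avoid each of the permutations in `B`. -/
def Av (B : Set FinPerm) : Set FinPerm :=
  {π | ∀ σ ∈ B, ¬ Involved σ π}

/-- Pattern avoidance classes. The forbidden permutations are nonempty words, so that every class
contains the empty permutation. -/
def IsPatternClass (A : Set FinPerm) : Prop :=
  ∃ B : Set FinPerm, (∀ σ ∈ B, 1 ≤ σ.1) ∧ A = Av B

/-- The pattern of the subsequence of `π` formed by the entries whose positions lie in `I`. -/
def subPattern {n : ℕ} (π : Equiv.Perm (Fin n)) (I : Finset (Fin n)) : FinPerm :=
  ⟨I.card, patternOf fun i : Fin I.card => π (I.orderEmbOfFin rfl i)⟩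

open Classical in
/-- `L_A(π)`: the maximum length of a subsequence of `π` whose pattern belongs to `A`. -/
noncomputable def longest (A : Set FinPerm) {n : ℕ} (π : Equiv.Perm (Fin n)) : ℕ :=
  (Finset.univ.filter fun I : Finset (Fin n) => subPattern π I ∈ A).sup Finset.card

/-- `E L_A(Π_n)`, for `Π_n` uniformly distributed over the `n!` permutations of length `n`. -/
noncomputable def meanLongest (A : Set FinPerm) (n : ℕ) : ℝ :=
  (∑ π : Equiv.Perm (Fin n), (longest A π : ℝ)) / (n.factorial : ℝ)

/-- The number of permutations of length `n` in `A`. -/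
noncomputable def count (A : Set FinPerm) (n : ℕ) : ℕ :=
  Set.ncard {π : Equiv.Perm (Fin n) | (⟨n, π⟩ : FinPerm) ∈ A}

/-- `s_A = limsup |S_n ∩ A|^(1/n)`. -/
noncomputable def sConst (A : Set FinPerm) : ℝ :=
  limsup (fun n : ℕ => (count A n : ℝ) ^ (1 / (n : ℝ))) atTop

/-- `c_A`, determined by `2 √c_A = limsup E L_A(Π_n) / √n`. -/
noncomputable def cConst (A : Set FinPerm) : ℝ :=
  (limsup (fun n : ℕ => meanLongest A n / √(n : ℝ)) atTop / 2) ^ 2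

/-- The limits superior defining `c_A` and `s_A` are (finite) limits, and `c_A = s_A`. -/
def SatisfiesConjecture (A : Set FinPerm) : Prop :=
  Tendsto (fun n : ℕ => (count A n : ℝ) ^ (1 / (n : ℝ))) atTop (𝓝 (sConst A)) ∧
  Tendsto (fun n : ℕ => meanLongest A n / √(n : ℝ)) atTop (𝓝 (2 * √(cConst A))) ∧
  cConst A = sConst A

/-- `α ⊕ β`: the word `α` followed by the word `β` shifted above all entries of `α`. -/
def permSum {m n : ℕ} (α : Equiv.Perm (Fin m)) (β : Equiv.Perm (Fin n)) :
    Equiv.Perm (Fin (m + n)) :=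
  finSumFinEquiv.permCongr (Equiv.Perm.sumCongr α β)

theorem permSum_castAdd {m n : ℕ} (α : Equiv.Perm (Fin m)) (β : Equiv.Perm (Fin n)) (i : Fin m) :
    permSum α β (Fin.castAdd n i) = Fin.castAdd n (α i) := by
  simp [permSum, Equiv.permCongr_apply]

theorem permSum_natAdd {m n : ℕ} (α : Equiv.Perm (Fin m)) (β : Equiv.Perm (Fin n)) (i : Fin n) :
    permSum α β (Fin.natAdd m i) = Fin.natAdd m (β i) := by
  simp [permSum, Equiv.permCongr_apply]

/-- The direct sum of two classes. -/
def directSum (A B : Set FinPerm) : Set FinPerm :=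
  {π | ∃ α ∈ A, ∃ β ∈ B, π = ⟨α.1 + β.1, permSum α.2 β.2⟩}

/-- The juxtaposition: permutations that are a concatenation of a (possibly empty) initial segment
with pattern in `A` and a (possibly empty) final segment with pattern in `B`. -/
def juxt (A B : Set FinPerm) : Set FinPerm :=
  {π | ∃ k ≤ π.1,
    subPattern π.2 (Finset.univ.filter fun i : Fin π.1 => (i : ℕ) < k) ∈ A ∧
    subPattern π.2 (Finset.univ.filter fun i : Fin π.1 => k ≤ (i : ℕ)) ∈ B}

/-- The merge: permutations whose positions split into a set on which the pattern is in `A` and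
a complementary set on which the pattern is in `B`. -/
def merge (A B : Set FinPerm) : Set FinPerm :=
  {π | ∃ I : Finset (Fin π.1), subPattern π.2 I ∈ A ∧ subPattern π.2 Iᶜ ∈ B}

end PermClass

namespace PermClass

/-! A set is an avoidance class exactly when it is closed under patterns of subsequences and
contains the empty permutation, so each construction yields a class once its elements are described
by sets of positions. What remains is to compute two limits for each construction, which `HasRate`
bundles around one number `s`.

Growth rates. For a fixed set of `k` positions, patterns in `A` on it and in `B` off it occur in
`n.choose k * count A k * count B (n - k)` permutations (`card_subPattern_mem_mem`). Summing over
cut points gives the binomial theorem, hence `a + b` for juxtapositions. Summing over all sets of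
positions gives squared binomial coefficients, hence `(√a + √b) ^ 2` by Cauchy–Schwarz. A
permutation is counted at most `n + 1` times in the first sum and, when `A ∩ B` is finite,
polynomially often in the second (`card_splittings_le`); such factors vanish under the `n`-th root.
Direct sums give an unweighted convolution and hence the maximum.

Mean lengths. For merges, the longest subsequences for `A` and `B` have bounded overlap, so their
lengths add up to a constant. Unions lie between the two classes and their direct sum, so one
argument serves parts 1 and 2. Lower bounds come from monotonicity, or from one fixed cut in the
case of juxtapositions.

The upper bounds for direct sums and juxtapositions are the hard part, because the optimal cut
depends on the permutation. Rounding cuts to a grid with `K` steps leaves a number of boxes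
independent of `n` (`sum_le_of_exists_box`). Within each box the length is concentrated: a
Poincaré-type inequality on the symmetric group (`variance_le_swapEnergy`), together with the fact
that a transposition can shorten an optimal subsequence only through its own entries, bounds the
variance by `2 * (1 + harmonic n)` times the mean. The total fluctuation is `o(√n)`, so the maximum
over boxes may be taken over means; these are compared by the AM-GM inequality for direct sums and
by Cauchy–Schwarz for juxtapositions, and then `K → ∞`. -/

/-! ### Patterns of subsequences and hereditary sets -/

/-- The only increasing bijection of `Fin k` onto itself is the identity, so a relative order
determines its permutation. -/
theorem patternOf_eq {α : Type*} [LinearOrder α] {k : ℕ} {f : Fin k → α}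
    (hf : Function.Injective f) (σ : Equiv.Perm (Fin k)) (h : ∀ i j, σ i < σ j ↔ f i < f j) :
    patternOf f = σ := by
  have hm : StrictMono (patternOf f * σ⁻¹) := by
    intro i j hij
    simp only [Equiv.Perm.coe_mul, Function.comp]
    rw [patternOf_lt_iff hf, ← h]
    simpa using hij
  have h2 : patternOf f * σ⁻¹ = 1 := by
    have := Subsingleton.elim (hm.orderIsoOfSurjective _ (Equiv.surjective _)) (OrderIso.refl _)
    ext i
    exact congrArg Fin.val (DFunLike.congr_fun this i)
  exact mul_inv_eq_one.1 h2

theorem injective_comp_orderEmb {n : ℕ} (π : Equiv.Perm (Fin n)) (I : Finset (Fin n)) :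
    Function.Injective fun i : Fin I.card => π (I.orderEmbOfFin rfl i) :=
  π.injective.comp (I.orderEmbOfFin rfl).injective

/-- The pattern of the subsequence of `π` at positions `I`, as a permutation of length `|I|`. -/
def pat {n : ℕ} (π : Equiv.Perm (Fin n)) (I : Finset (Fin n)) : Equiv.Perm (Fin I.card) :=
  patternOf fun i => π (I.orderEmbOfFin rfl i)

theorem subPattern_def {n : ℕ} (π : Equiv.Perm (Fin n)) (I : Finset (Fin n)) :
    subPattern π I = ⟨I.card, pat π I⟩ := rfl

theorem pat_lt_iff {n : ℕ} (π : Equiv.Perm (Fin n)) (I : Finset (Fin n))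
    (s t : Fin I.card) :
    pat π I s < pat π I t ↔
      π (I.orderEmbOfFin rfl s) < π (I.orderEmbOfFin rfl t) :=
  patternOf_lt_iff (injective_comp_orderEmb π I) s t

theorem subPattern_eq {n k : ℕ} {π : Equiv.Perm (Fin n)} {I : Finset (Fin n)}
    {σ : Equiv.Perm (Fin k)} (g : Fin k → Fin n) (hg : StrictMono g)
    (hI : Finset.univ.image g = I) (h : ∀ s t, σ s < σ t ↔ π (g s) < π (g t)) :
    subPattern π I = ⟨k, σ⟩ := by
  obtain rfl : k = I.card := by
    rw [← hI, Finset.card_image_of_injective _ hg.injective, Finset.card_univ, Fintype.card_fin]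
  have hg' : g = I.orderEmbOfFin rfl := Finset.orderEmbOfFin_unique rfl
    (fun x => by rw [← hI]; exact Finset.mem_image_of_mem _ (Finset.mem_univ _)) hg
  subst hg'
  have := patternOf_eq (injective_comp_orderEmb π I) σ h
  rw [subPattern_def, pat, this]

theorem subPattern_congr {n : ℕ} {π π' : Equiv.Perm (Fin n)} {I : Finset (Fin n)}
    (h : ∀ i ∈ I, π i = π' i) : subPattern π I = subPattern π' I := by
  unfold subPattern
  congr 2
  funext i
  exact h _ (I.orderEmbOfFin_mem rfl i)

theorem subPattern_univ {n : ℕ} (π : Equiv.Perm (Fin n)) :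
    subPattern π Finset.univ = ⟨n, π⟩ :=
  subPattern_eq id strictMono_id (by simp) fun _ _ => Iff.rfl

theorem subPattern_subPattern {n : ℕ} (π : Equiv.Perm (Fin n)) (J : Finset (Fin n))
    (K : Finset (Fin J.card)) :
    subPattern (pat π J) K =
      subPattern π (K.map (J.orderEmbOfFin rfl).toEmbedding) := by
  symm
  refine subPattern_eq (σ := pat (pat π J) K)
    (fun i => J.orderEmbOfFin rfl (K.orderEmbOfFin rfl i))
    ((J.orderEmbOfFin rfl).strictMono.comp (K.orderEmbOfFin rfl).strictMono) ?_ ?_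
  · ext x
    have hK : ∀ y, y ∈ K ↔ ∃ a, K.orderEmbOfFin rfl a = y := fun y => by
      rw [← Finset.mem_coe, ← K.range_orderEmbOfFin rfl, Set.mem_range]
    simp only [Finset.mem_image, Finset.mem_univ, true_and, Finset.mem_map, hK]
    constructor
    · rintro ⟨a, rfl⟩
      exact ⟨_, ⟨a, rfl⟩, rfl⟩
    · rintro ⟨_, ⟨a, rfl⟩, rfl⟩
      exact ⟨a, rfl⟩
  · intro s t
    rw [pat_lt_iff]
    exact pat_lt_iff π J _ _

/-- The indices, within the increasing enumeration of `J`, of the elements of `J` satisfying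
`p`. -/
def indicesIn {n : ℕ} (J : Finset (Fin n)) (p : Fin n → Prop) [DecidablePred p] :
    Finset (Fin J.card) :=
  Finset.univ.filter fun i => p (J.orderEmbOfFin rfl i)

theorem map_indicesIn {n : ℕ} (J : Finset (Fin n)) (p : Fin n → Prop) [DecidablePred p] :
    (indicesIn J p).map (J.orderEmbOfFin rfl).toEmbedding = J.filter p := by
  ext x
  have hJ : x ∈ J ↔ ∃ a, J.orderEmbOfFin rfl a = x := by
    rw [← Finset.mem_coe, ← J.range_orderEmbOfFin rfl, Set.mem_range]
  simp only [indicesIn, Finset.mem_map, Finset.mem_filter, Finset.mem_univ, true_and, hJ]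
  constructor
  · rintro ⟨a, ha, rfl⟩
    exact ⟨⟨a, rfl⟩, ha⟩
  · rintro ⟨⟨a, rfl⟩, ha⟩
    exact ⟨a, ha, rfl⟩

theorem subPattern_indicesIn {n : ℕ} (π : Equiv.Perm (Fin n)) (J : Finset (Fin n))
    (p : Fin n → Prop) [DecidablePred p] :
    subPattern (pat π J) (indicesIn J p) = subPattern π (J.filter p) := by
  rw [subPattern_subPattern, map_indicesIn]

theorem involved_iff {σ π : FinPerm} : Involved σ π ↔ ∃ I, subPattern π.2 I = σ := by
  constructor
  · rintro ⟨g, hg, h⟩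
    exact ⟨_, subPattern_eq g hg rfl h⟩
  · rintro ⟨I, rfl⟩
    exact ⟨I.orderEmbOfFin rfl, (I.orderEmbOfFin rfl).strictMono, pat_lt_iff π.2 I⟩

/-- A set of permutations closed under taking patterns of subsequences. -/
def Hereditary (A : Set FinPerm) : Prop :=
  ∀ ⦃n : ℕ⦄ (π : Equiv.Perm (Fin n)) (I : Finset (Fin n)), ⟨n, π⟩ ∈ A → subPattern π I ∈ A

theorem finPerm_eq_of_length_eq_zero {σ τ : FinPerm} (hσ : σ.1 = 0) (hτ : τ.1 = 0) : σ = τ := by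
  obtain ⟨n, σ⟩ := σ
  obtain ⟨m, τ⟩ := τ
  simp only at hσ hτ
  subst hσ hτ
  rw [Subsingleton.elim σ τ]

/-- A hereditary set is recovered by forbidding its whole complement; the empty permutation is a
member precisely so that nothing of length zero is forbidden. -/
theorem isPatternClass_iff {A : Set FinPerm} :
    IsPatternClass A ↔ Hereditary A ∧ (⟨0, 1⟩ : FinPerm) ∈ A := by
  constructor
  · rintro ⟨B, hB, rfl⟩
    refine ⟨fun n π I hπ σ hσ hinv => ?_, fun σ hσ hinv => ?_⟩
    · obtain ⟨K, hK⟩ := involved_iff.1 hinv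
      exact hπ σ hσ (involved_iff.2 ⟨_, (subPattern_subPattern π I K).symm.trans hK⟩)
    · obtain ⟨g, -, -⟩ := hinv
      exact (g ⟨0, hB σ hσ⟩).elim0
  · rintro ⟨hA, h0⟩
    refine ⟨Aᶜ, fun σ hσ => ?_, ?_⟩
    · by_contra hlt
      exact hσ (finPerm_eq_of_length_eq_zero (σ := σ) (τ := ⟨0, 1⟩) (by omega) rfl ▸ h0)
    · ext π
      constructor
      · intro hπ σ hσ hinv
        obtain ⟨I, rfl⟩ := involved_iff.1 hinv
        exact hσ (hA _ _ hπ)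
      · intro hπ
        by_contra hn
        exact hπ π hn (involved_iff.2 ⟨Finset.univ, subPattern_univ _⟩)

theorem Hereditary.subPattern_mem {A : Set FinPerm} (hA : Hereditary A) {n : ℕ}
    {π : Equiv.Perm (Fin n)} {I J : Finset (Fin n)} (hIJ : I ⊆ J) (hJ : subPattern π J ∈ A) :
    subPattern π I ∈ A := by
  have := hA (pat π J) (indicesIn J (· ∈ I)) hJ
  rwa [subPattern_indicesIn, Finset.filter_mem_eq_inter, Finset.inter_eq_right.2 hIJ] at this

theorem mem_of_length_eq_zero {A : Set FinPerm} (hA : (⟨0, 1⟩ : FinPerm) ∈ A) {σ : FinPerm}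
    (hσ : σ.1 = 0) : σ ∈ A :=
  finPerm_eq_of_length_eq_zero (σ := ⟨0, 1⟩) rfl hσ ▸ hA

theorem exists_lt_iff_of_antitone {m : ℕ} (P : Fin m → Prop)
    (hP : ∀ i j, i ≤ j → P j → P i) : ∃ k ≤ m, ∀ i : Fin m, P i ↔ (i : ℕ) < k := by
  classical
  have hex : ∃ k : ℕ, ∀ h : k < m, ¬ P ⟨k, h⟩ := ⟨m, fun h => absurd h (lt_irrefl m)⟩
  refine ⟨Nat.find hex, Nat.find_min' hex fun h => absurd h (lt_irrefl m), fun i => ?_⟩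
  constructor
  · intro hi
    by_contra hlt
    have hle : Nat.find hex ≤ i := not_lt.1 hlt
    exact Nat.find_spec hex (hle.trans_lt i.2) (hP _ i hle hi)
  · intro hi
    have := Nat.find_min hex hi
    push Not at this
    exact this.2

/-! ### The constructions described by sets of positions -/

theorem mem_merge_iff {A B : Set FinPerm} {n : ℕ} {π : Equiv.Perm (Fin n)} :
    (⟨n, π⟩ : FinPerm) ∈ merge A B ↔
      ∃ I : Finset (Fin n), subPattern π I ∈ A ∧ subPattern π Iᶜ ∈ B := Iff.rfl

theorem mem_juxt_iff {A B : Set FinPerm} {n : ℕ} {π : Equiv.Perm (Fin n)} :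
    (⟨n, π⟩ : FinPerm) ∈ juxt A B ↔
      ∃ k ≤ n, subPattern π (Finset.univ.filter fun i : Fin n => (i : ℕ) < k) ∈ A ∧
        subPattern π (Finset.univ.filter fun i : Fin n => k ≤ (i : ℕ)) ∈ B := Iff.rfl

theorem subPattern_mem_merge {A B : Set FinPerm} {n : ℕ} {π : Equiv.Perm (Fin n)}
    {J : Finset (Fin n)} : subPattern π J ∈ merge A B ↔
      ∃ I : Finset (Fin n), subPattern π (J.filter (· ∈ I)) ∈ A ∧
        subPattern π (J.filter (· ∉ I)) ∈ B := by
  constructor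
  · intro h
    obtain ⟨K, hA, hB⟩ := mem_merge_iff.1 h
    refine ⟨K.map (J.orderEmbOfFin rfl).toEmbedding, ?_, ?_⟩
    · convert hA using 1
      rw [← subPattern_indicesIn]
      congr 1
      ext i
      simp only [indicesIn, Finset.mem_filter, Finset.mem_univ, true_and]
      exact Finset.mem_map' _
    · convert hB using 1
      rw [← subPattern_indicesIn]
      congr 1
      ext i
      simp only [indicesIn, Finset.mem_filter, Finset.mem_univ, true_and, Finset.mem_compl]
      exact not_congr (Finset.mem_map' _)
  · rintro ⟨I, hA, hB⟩
    rw [← subPattern_indicesIn] at hA hB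
    refine mem_merge_iff.2 ⟨indicesIn J (· ∈ I), hA, ?_⟩
    convert hB using 1
    congr 1
    ext i
    simp [indicesIn]

theorem Hereditary.merge {A B : Set FinPerm} (hA : Hereditary A) (hB : Hereditary B) :
    Hereditary (merge A B) := by
  rintro n π J ⟨I, h1, h2⟩
  refine subPattern_mem_merge.2 ⟨I, hA.subPattern_mem ?_ h1, hB.subPattern_mem ?_ h2⟩
  · exact fun x hx => (Finset.mem_filter.1 hx).2
  · exact fun x hx => Finset.mem_compl.2 (Finset.mem_filter.1 hx).2

/-- Translates a cut among the indices of `J` into a cut among the positions of the ambient word. If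
`k = J.card` there is no `k`-th element to cut at, and `n` serves instead. -/
theorem exists_orderEmb_lt_iff {n : ℕ} (J : Finset (Fin n)) {k : ℕ} (hk : k ≤ J.card) :
    ∃ t ≤ n, ∀ i : Fin J.card, (i : ℕ) < k ↔ (J.orderEmbOfFin rfl i : ℕ) < t := by
  rcases hk.lt_or_eq with h | rfl
  · refine ⟨J.orderEmbOfFin rfl ⟨k, h⟩, (J.orderEmbOfFin rfl ⟨k, h⟩).2.le, fun i => ?_⟩
    rw [← Fin.lt_def, (J.orderEmbOfFin rfl).lt_iff_lt, Fin.lt_def]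
  · exact ⟨n, le_rfl, fun i => ⟨fun _ => Fin.is_lt _, fun _ => i.2⟩⟩

theorem subPattern_mem_juxt {A B : Set FinPerm} {n : ℕ} {π : Equiv.Perm (Fin n)}
    {J : Finset (Fin n)} : subPattern π J ∈ juxt A B ↔
      ∃ t ≤ n, subPattern π (J.filter fun i : Fin n => (i : ℕ) < t) ∈ A ∧
        subPattern π (J.filter fun i : Fin n => t ≤ (i : ℕ)) ∈ B := by
  constructor
  · intro h
    obtain ⟨k, hk, hA, hB⟩ := mem_juxt_iff.1 h
    obtain ⟨t, htn, ht⟩ := exists_orderEmb_lt_iff J hk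
    refine ⟨t, htn, ?_, ?_⟩
    · convert hA using 1
      rw [← subPattern_indicesIn]
      congr 1
      ext i
      simp [indicesIn, ← ht]
    · convert hB using 1
      rw [← subPattern_indicesIn]
      congr 1
      ext i
      simp only [indicesIn, Finset.mem_filter, Finset.mem_univ, true_and]
      rw [← not_lt, ← ht, not_lt]
  · rintro ⟨t, htn, hA, hB⟩
    obtain ⟨k, hk, h⟩ := exists_lt_iff_of_antitone
      (fun i : Fin J.card => (J.orderEmbOfFin rfl i : ℕ) < t)
      (fun i j hij hj => lt_of_le_of_lt ((J.orderEmbOfFin rfl).monotone hij) hj)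
    rw [← subPattern_indicesIn] at hA hB
    refine mem_juxt_iff.2 ⟨k, hk, ?_, ?_⟩
    · convert hA using 1
      congr 1
      ext i
      simp [indicesIn, h]
    · convert hB using 1
      congr 1
      ext i
      simp only [indicesIn, Finset.mem_filter, Finset.mem_univ, true_and]
      rw [← not_lt, ← h i, not_lt]

theorem Hereditary.juxt {A B : Set FinPerm} (hA : Hereditary A) (hB : Hereditary B) :
    Hereditary (juxt A B) := by
  rintro n π J ⟨k, hk, h1, h2⟩
  exact subPattern_mem_juxt.2 ⟨k, hk, hA.subPattern_mem (Finset.filter_subset_filter _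
    (Finset.subset_univ J)) h1, hB.subPattern_mem (Finset.filter_subset_filter _
    (Finset.subset_univ J)) h2⟩

theorem subPattern_permSum_left {m n : ℕ} (α : Equiv.Perm (Fin m)) (β : Equiv.Perm (Fin n)) :
    subPattern (permSum α β) (Finset.univ.filter fun i : Fin (m + n) => (i : ℕ) < m) = ⟨m, α⟩ := by
  refine subPattern_eq (Fin.castAdd n) (Fin.strictMono_castAdd n) ?_ fun s t => ?_
  · ext x
    induction x using Fin.addCases with
    | left i => simp
    | right i =>
      simp only [Finset.mem_image, Finset.mem_univ, true_and, Finset.mem_filter, Fin.val_natAdd]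
      refine iff_of_false ?_ (by omega)
      rintro ⟨j, hj⟩
      have := congrArg Fin.val hj
      simp only [Fin.val_natAdd, Fin.val_castAdd] at this
      omega
  · rw [permSum_castAdd, permSum_castAdd, (Fin.strictMono_castAdd n).lt_iff_lt]

theorem subPattern_permSum_right {m n : ℕ} (α : Equiv.Perm (Fin m)) (β : Equiv.Perm (Fin n)) :
    subPattern (permSum α β) (Finset.univ.filter fun i : Fin (m + n) => m ≤ (i : ℕ)) = ⟨n, β⟩ := by
  refine subPattern_eq (Fin.natAdd m) (Fin.strictMono_natAdd m) ?_ fun s t => ?_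
  · ext x
    induction x using Fin.addCases with
    | left i =>
      simp only [Finset.mem_image, Finset.mem_univ, true_and, Finset.mem_filter, Fin.val_castAdd]
      refine iff_of_false ?_ (by omega)
      rintro ⟨j, hj⟩
      have := congrArg Fin.val hj
      simp only [Fin.val_natAdd, Fin.val_castAdd] at this
      omega
    | right i => simp
  · rw [permSum_natAdd, permSum_natAdd, (Fin.strictMono_natAdd m).lt_iff_lt]

/-- A direct sum is a juxtaposition whose cut in positions is at the same time a cut in values: `t`
is the first and `u` the second. -/
theorem mem_directSum_iff {A B : Set FinPerm} {n : ℕ} {π : Equiv.Perm (Fin n)} :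
    (⟨n, π⟩ : FinPerm) ∈ directSum A B ↔ ∃ t ≤ n, ∃ u ≤ n,
      (∀ i : Fin n, (i : ℕ) < t ↔ (π i : ℕ) < u) ∧
      subPattern π (Finset.univ.filter fun i : Fin n => (i : ℕ) < t) ∈ A ∧
      subPattern π (Finset.univ.filter fun i : Fin n => t ≤ (i : ℕ)) ∈ B := by
  constructor
  · rintro ⟨⟨a, α⟩, hα, ⟨b, β⟩, hβ, h⟩
    obtain ⟨rfl, h⟩ := Sigma.mk.inj_iff.1 h
    obtain rfl := eq_of_heq h
    refine ⟨a, Nat.le_add_right _ _, a, Nat.le_add_right _ _, fun i => ?_, ?_, ?_⟩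
    · induction i using Fin.addCases with
      | left i => simp [permSum_castAdd]
      | right i => simp [permSum_natAdd]
    · simpa only [subPattern_permSum_left] using hα
    · simpa only [subPattern_permSum_right] using hβ
  · rintro ⟨t, -, u, -, htu, hA, hB⟩
    refine ⟨_, hA, _, hB, ?_⟩
    rw [← subPattern_univ]
    set I := Finset.univ.filter fun i : Fin n => (i : ℕ) < t with hI
    set J := Finset.univ.filter fun i : Fin n => t ≤ (i : ℕ) with hJ
    have memI : ∀ i, ((I.orderEmbOfFin rfl i : Fin n) : ℕ) < t := fun i => by
      have := I.orderEmbOfFin_mem rfl i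
      exact (Finset.mem_filter.1 this).2
    have memJ : ∀ i, t ≤ ((J.orderEmbOfFin rfl i : Fin n) : ℕ) := fun i => by
      have := J.orderEmbOfFin_mem rfl i
      exact (Finset.mem_filter.1 this).2
    have memI' : ∀ i, (π (I.orderEmbOfFin rfl i) : ℕ) < u := fun i => (htu _).1 (memI i)
    have memJ' : ∀ i, u ≤ (π (J.orderEmbOfFin rfl i) : ℕ) := fun i =>
      not_lt.1 fun h => absurd ((htu _).2 h) (not_lt.2 (memJ i))
    refine subPattern_eq (k := I.card + J.card)
      (Fin.addCases (I.orderEmbOfFin rfl) (J.orderEmbOfFin rfl)) ?_ ?_ ?_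
    · intro x y hxy
      induction x using Fin.addCases with
      | left x =>
        induction y using Fin.addCases with
        | left y =>
          simpa using (Fin.strictMono_castAdd _).lt_iff_lt.1 hxy
        | right y =>
          simp only [Fin.addCases_left, Fin.addCases_right]
          exact Fin.lt_def.2 <| lt_of_lt_of_le (memI x) (memJ y)
      | right x =>
        induction y using Fin.addCases with
        | left y =>
          have := Fin.lt_def.1 hxy
          simp at this
          omega
        | right y => simpa using hxy
    · refine Finset.eq_univ_of_forall fun x => ?_
      rw [Finset.mem_image]
      by_cases hx : (x : ℕ) < t
      · have : x ∈ Set.range (I.orderEmbOfFin rfl) := by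
          rw [I.range_orderEmbOfFin rfl]; simp [hI, hx]
        obtain ⟨a, rfl⟩ := this
        exact ⟨Fin.castAdd _ a, Finset.mem_univ _, by simp⟩
      · have : x ∈ Set.range (J.orderEmbOfFin rfl) := by
          rw [J.range_orderEmbOfFin rfl]; simp [hJ, not_lt.1 hx]
        obtain ⟨a, rfl⟩ := this
        exact ⟨Fin.natAdd _ a, Finset.mem_univ _, by simp⟩
    · intro s r
      induction s using Fin.addCases with
      | left s =>
        induction r using Fin.addCases with
        | left r =>
          erw [permSum_castAdd, permSum_castAdd]
          simp only [Fin.addCases_left]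
          exact ((Fin.strictMono_castAdd _).lt_iff_lt).trans (pat_lt_iff π I s r)
        | right r =>
          erw [permSum_castAdd, permSum_natAdd]
          simp only [Fin.addCases_left, Fin.addCases_right]
          refine iff_of_true ?_ (Fin.lt_def.2 (lt_of_lt_of_le (memI' s) (memJ' r)))
          exact Fin.lt_def.2 (by rw [Fin.val_castAdd, Fin.val_natAdd]; omega)
      | right s =>
        induction r using Fin.addCases with
        | left r =>
          erw [permSum_castAdd, permSum_natAdd]
          simp only [Fin.addCases_left, Fin.addCases_right]
          refine iff_of_false (lt_asymm ?_) (lt_asymm (Fin.lt_def.2 (lt_of_lt_of_le (memI' r) (memJ' s))))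
          exact Fin.lt_def.2 (by rw [Fin.val_castAdd, Fin.val_natAdd]; omega)
        | right r =>
          erw [permSum_natAdd, permSum_natAdd]
          simp only [Fin.addCases_right]
          exact ((Fin.strictMono_natAdd _).lt_iff_lt).trans (pat_lt_iff π J s r)

/-- The thresholds refer to `π` itself, so they need to be compatible only at positions of `J`; this
is what lets them be rounded to a grid later. -/
theorem subPattern_mem_directSum {A B : Set FinPerm} {n : ℕ} {π : Equiv.Perm (Fin n)}
    {J : Finset (Fin n)} : subPattern π J ∈ directSum A B ↔
      ∃ t ≤ n, ∃ u ≤ n, (∀ i ∈ J, (i : ℕ) < t ↔ (π i : ℕ) < u) ∧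
        subPattern π (J.filter fun i : Fin n => (i : ℕ) < t) ∈ A ∧
        subPattern π (J.filter fun i : Fin n => t ≤ (i : ℕ)) ∈ B := by
  have hJ : ∀ i ∈ J, ∃ a, J.orderEmbOfFin rfl a = i := fun i hi => by
    rwa [← Finset.mem_coe, ← J.range_orderEmbOfFin rfl, Set.mem_range] at hi
  constructor
  · intro h
    obtain ⟨k, hk, k', hk', hkk, hA, hB⟩ := (mem_directSum_iff (π := pat π J)).1 h
    obtain ⟨t, htn, ht⟩ := exists_orderEmb_lt_iff J hk
    have hu : ∃ u ≤ n, ∀ i : Fin J.card,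
        ((pat π J) i : ℕ) < k' ↔ (π (J.orderEmbOfFin rfl i) : ℕ) < u := by
      rcases hk'.lt_or_eq with h | h
      · refine ⟨π (J.orderEmbOfFin rfl ((pat π J).symm ⟨k', h⟩)), (Fin.is_lt _).le,
          fun i => ?_⟩
        rw [← Fin.lt_def, ← pat_lt_iff, Fin.lt_def, Equiv.apply_symm_apply]
      · exact ⟨n, le_rfl, fun i => ⟨fun _ => Fin.is_lt _, fun _ => (Fin.is_lt _).trans_eq h.symm⟩⟩
    obtain ⟨u, hun, hu⟩ := hu
    refine ⟨t, htn, u, hun, fun i hi => ?_, ?_, ?_⟩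
    · obtain ⟨a, rfl⟩ := hJ i hi
      rw [← ht, ← hu, ← hkk]
    · convert hA using 1
      rw [← subPattern_indicesIn]
      congr 1
      ext i
      simp [indicesIn, ← ht]
    · convert hB using 1
      rw [← subPattern_indicesIn]
      congr 1
      ext i
      simp only [indicesIn, Finset.mem_filter, Finset.mem_univ, true_and]
      rw [← not_lt, ← ht, not_lt]
  · rintro ⟨t, htn, u, hun, htu, hA, hB⟩
    obtain ⟨k, hk, h⟩ := exists_lt_iff_of_antitone
      (fun i : Fin J.card => (J.orderEmbOfFin rfl i : ℕ) < t)
      (fun i j hij hj => lt_of_le_of_lt ((J.orderEmbOfFin rfl).monotone hij) hj)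
    obtain ⟨k', hk', h'⟩ := exists_lt_iff_of_antitone
      (fun i : Fin J.card => (π (J.orderEmbOfFin rfl ((pat π J).symm i)) : ℕ) < u)
      (fun i j hij hj => by
        refine lt_of_le_of_lt ?_ hj
        rw [← Fin.le_def, ← not_lt, ← pat_lt_iff]
        simpa using hij)
    rw [← subPattern_indicesIn] at hA hB
    refine (mem_directSum_iff (π := pat π J)).2 ⟨k, hk, k', hk', fun i => ?_, ?_, ?_⟩
    · rw [← h, htu _ (J.orderEmbOfFin_mem rfl i), ← h', Equiv.symm_apply_apply]
    · convert hA using 1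
      congr 1
      ext i
      simp [indicesIn, h]
    · convert hB using 1
      congr 1
      ext i
      simp only [indicesIn, Finset.mem_filter, Finset.mem_univ, true_and]
      rw [← not_lt, ← h i, not_lt]

theorem Hereditary.directSum {A B : Set FinPerm} (hA : Hereditary A) (hB : Hereditary B) :
    Hereditary (directSum A B) := by
  intro n π J h
  obtain ⟨t, ht, u, hu, htu, h1, h2⟩ := mem_directSum_iff.1 h
  exact subPattern_mem_directSum.2 ⟨t, ht, u, hu, fun i _ => htu i,
    hA.subPattern_mem (Finset.filter_subset_filter _ (Finset.subset_univ J)) h1,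
    hB.subPattern_mem (Finset.filter_subset_filter _ (Finset.subset_univ J)) h2⟩

theorem subset_directSum_left {A B : Set FinPerm} (hB : (⟨0, 1⟩ : FinPerm) ∈ B) :
    A ⊆ directSum A B := by
  rintro ⟨n, π⟩ h
  refine mem_directSum_iff.2 ⟨n, le_rfl, n, le_rfl, fun i => by simp, ?_, ?_⟩
  · simpa [subPattern_univ] using h
  · refine mem_of_length_eq_zero hB ?_
    simp [subPattern]

theorem subset_directSum_right {A B : Set FinPerm} (hA : (⟨0, 1⟩ : FinPerm) ∈ A) :
    B ⊆ directSum A B := by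
  rintro ⟨n, π⟩ h
  refine mem_directSum_iff.2 ⟨0, Nat.zero_le _, 0, Nat.zero_le _, fun i => by simp, ?_, ?_⟩
  · refine mem_of_length_eq_zero hA ?_
    simp [subPattern]
  · simpa [subPattern_univ] using h

theorem isPatternClass_union {A B : Set FinPerm} (hA : IsPatternClass A)
    (hB : IsPatternClass B) : IsPatternClass (A ∪ B) := by
  rw [isPatternClass_iff] at *
  refine ⟨fun n π I h => ?_, Or.inl hA.2⟩
  exact h.imp (hA.1 π I) (hB.1 π I)

theorem isPatternClass_directSum {A B : Set FinPerm} (hA : IsPatternClass A)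
    (hB : IsPatternClass B) : IsPatternClass (directSum A B) := by
  rw [isPatternClass_iff] at *
  exact ⟨hA.1.directSum hB.1, subset_directSum_left hB.2 hA.2⟩

theorem isPatternClass_juxt {A B : Set FinPerm} (hA : IsPatternClass A)
    (hB : IsPatternClass B) : IsPatternClass (juxt A B) := by
  rw [isPatternClass_iff] at *
  exact ⟨hA.1.juxt hB.1, 0, le_rfl, mem_of_length_eq_zero hA.2 (by simp [subPattern]),
    mem_of_length_eq_zero hB.2 (by simp [subPattern])⟩

theorem isPatternClass_merge {A B : Set FinPerm} (hA : IsPatternClass A)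
    (hB : IsPatternClass B) : IsPatternClass (merge A B) := by
  rw [isPatternClass_iff] at *
  exact ⟨hA.1.merge hB.1, ∅, mem_of_length_eq_zero hA.2 (by simp [subPattern]),
    mem_of_length_eq_zero hB.2 (by simp [subPattern])⟩

/-! ### Rearranging the entries on a set of positions -/

open Classical in
/-- The permutation of `Fin n` that permutes the elements of `I` according to `ρ` and fixes all
other points. -/
noncomputable def extendPerm {n : ℕ} (I : Finset (Fin n)) (ρ : Equiv.Perm (Fin I.card)) :
    Equiv.Perm (Fin n) :=
  ρ.extendDomain (I.orderIsoOfFin rfl).toEquiv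

theorem extendPerm_orderEmb {n : ℕ} (I : Finset (Fin n)) (ρ : Equiv.Perm (Fin I.card))
    (i : Fin I.card) :
    extendPerm I ρ (I.orderEmbOfFin rfl i) = I.orderEmbOfFin rfl (ρ i) := by
  have := ρ.extendDomain_apply_image (I.orderIsoOfFin rfl).toEquiv i
  simpa [extendPerm] using this

theorem extendPerm_of_notMem {n : ℕ} {I : Finset (Fin n)} (ρ : Equiv.Perm (Fin I.card))
    {i : Fin n} (hi : i ∉ I) : extendPerm I ρ i = i :=
  ρ.extendDomain_apply_not_subtype _ hi

theorem exists_orderEmb_eq {n : ℕ} {I : Finset (Fin n)} {i : Fin n} (hi : i ∈ I) :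
    ∃ a, I.orderEmbOfFin rfl a = i := by
  rwa [← Finset.mem_coe, ← I.range_orderEmbOfFin rfl, Set.mem_range] at hi

theorem extendPerm_mem_iff {n : ℕ} {I : Finset (Fin n)} (ρ : Equiv.Perm (Fin I.card))
    {i : Fin n} : extendPerm I ρ i ∈ I ↔ i ∈ I := by
  by_cases hi : i ∈ I
  · obtain ⟨a, rfl⟩ := exists_orderEmb_eq hi
    simp [extendPerm_orderEmb]
  · rw [extendPerm_of_notMem ρ hi]

theorem pat_mul_extendPerm {n : ℕ} (π : Equiv.Perm (Fin n)) (I : Finset (Fin n))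
    (ρ : Equiv.Perm (Fin I.card)) : pat (π * extendPerm I ρ) I = pat π I * ρ := by
  refine patternOf_eq (injective_comp_orderEmb _ I) _ fun i j => ?_
  simp only [Equiv.Perm.mul_apply, extendPerm_orderEmb]
  exact pat_lt_iff π I _ _

/-- Independence in integrated form: for random `π` the pattern on `I` is uniform and independent of
every quantity that does not change when the entries on `I` are rearranged. The proof averages over
all rearrangements `ρ`. -/
theorem sum_pat_mul {n : ℕ} (I : Finset (Fin n)) (X : Equiv.Perm (Fin I.card) → ℝ)
    (Y : Equiv.Perm (Fin n) → ℝ) (hY : ∀ π ρ, Y (π * extendPerm I ρ) = Y π) :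
    (I.card.factorial : ℝ) * ∑ π, X (pat π I) * Y π = (∑ ρ, X ρ) * ∑ π, Y π := by
  have h1 : ∀ ρ : Equiv.Perm (Fin I.card),
      ∑ π, X (pat π I * ρ) * Y π = ∑ π, X (pat π I) * Y π := fun ρ => by
    rw [← Equiv.sum_comp (Equiv.mulRight (extendPerm I ρ)) fun π => X (pat π I) * Y π]
    exact Finset.sum_congr rfl fun π _ => by
      rw [Equiv.coe_mulRight, pat_mul_extendPerm, hY]
  calc (I.card.factorial : ℝ) * ∑ π, X (pat π I) * Y π
      = ∑ ρ : Equiv.Perm (Fin I.card), ∑ π, X (pat π I * ρ) * Y π := by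
        simp only [h1, Finset.sum_const, Finset.card_univ, Fintype.card_perm, Fintype.card_fin,
          nsmul_eq_mul]
    _ = ∑ π, (∑ ρ, X ρ) * Y π := by
        rw [Finset.sum_comm]
        refine Finset.sum_congr rfl fun π _ => ?_
        rw [← Finset.sum_mul]
        congr 1
        exact Equiv.sum_comp (Equiv.mulLeft (pat π I)) X
    _ = _ := by rw [Finset.mul_sum]

/-! ### Longest subsequences within a box of positions and values -/

open Classical in
/-- The maximum length of a subsequence of `π` with positions in `S` and pattern in `A`. -/
noncomputable def longestIn (A : Set FinPerm) {n : ℕ} (π : Equiv.Perm (Fin n))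
    (S : Finset (Fin n)) : ℕ :=
  (S.powerset.filter fun I => subPattern π I ∈ A).sup Finset.card

theorem le_longestIn {A : Set FinPerm} {n : ℕ} {π : Equiv.Perm (Fin n)} {S J : Finset (Fin n)}
    (hJ : J ⊆ S) (h : subPattern π J ∈ A) : J.card ≤ longestIn A π S := by
  classical
  unfold longestIn
  apply Finset.le_sup (f := Finset.card)
  exact Finset.mem_filter.2 ⟨Finset.mem_powerset.2 hJ, h⟩

theorem exists_card_eq_longestIn {A : Set FinPerm} (hA : (⟨0, 1⟩ : FinPerm) ∈ A) {n : ℕ}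
    (π : Equiv.Perm (Fin n)) (S : Finset (Fin n)) :
    ∃ J ⊆ S, subPattern π J ∈ A ∧ J.card = longestIn A π S := by
  classical
  obtain ⟨J, hJ, h⟩ := Finset.exists_mem_eq_sup
    (S.powerset.filter fun I => subPattern π I ∈ A)
    ⟨∅, Finset.mem_filter.2 ⟨Finset.empty_mem_powerset S, mem_of_length_eq_zero hA rfl⟩⟩
    Finset.card
  rw [Finset.mem_filter, Finset.mem_powerset] at hJ
  refine ⟨J, hJ.1, hJ.2, ?_⟩
  rw [longestIn]
  convert h.symm

theorem longest_eq_longestIn (A : Set FinPerm) {n : ℕ} (π : Equiv.Perm (Fin n)) :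
    longest A π = longestIn A π Finset.univ := by
  rw [longest, longestIn, Finset.powerset_univ]

theorem longest_pat {A : Set FinPerm} (hA : (⟨0, 1⟩ : FinPerm) ∈ A) {n : ℕ}
    (π : Equiv.Perm (Fin n)) (S : Finset (Fin n)) :
    longest A (pat π S) = longestIn A π S := by
  rw [longest_eq_longestIn]
  apply le_antisymm
  · obtain ⟨K, -, hK, hc⟩ := exists_card_eq_longestIn hA (pat π S) Finset.univ
    rw [subPattern_subPattern] at hK
    rw [← hc, ← Finset.card_map (S.orderEmbOfFin rfl).toEmbedding]
    refine le_longestIn (fun x hx => ?_) hK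
    obtain ⟨a, -, rfl⟩ := Finset.mem_map.1 hx
    exact S.orderEmbOfFin_mem rfl a
  · obtain ⟨J, hJS, hJ, hc⟩ := exists_card_eq_longestIn hA π S
    rw [← Finset.inter_eq_right.2 hJS, ← Finset.filter_mem_eq_inter] at hJ hc
    rw [← subPattern_indicesIn] at hJ
    rw [← hc, ← map_indicesIn, Finset.card_map]
    exact le_longestIn (Finset.subset_univ _) hJ

theorem sum_longestIn_mul {A : Set FinPerm} (hA : (⟨0, 1⟩ : FinPerm) ∈ A) {n : ℕ}
    (S : Finset (Fin n)) (Y : Equiv.Perm (Fin n) → ℝ)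
    (hY : ∀ π ρ, Y (π * extendPerm S ρ) = Y π) :
    ∑ π, (longestIn A π S : ℝ) * Y π = meanLongest A S.card * ∑ π, Y π := by
  have h := sum_pat_mul S (fun ρ => (longest A ρ : ℝ)) Y hY
  simp only [longest_pat hA] at h
  have hpos : (0 : ℝ) < S.card.factorial := by exact_mod_cast Nat.factorial_pos _
  rw [meanLongest, div_mul_eq_mul_div, eq_div_iff hpos.ne', mul_comm, h]

theorem sum_longestIn {A : Set FinPerm} (hA : (⟨0, 1⟩ : FinPerm) ∈ A) {n : ℕ}
    (S : Finset (Fin n)) :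
    ∑ π, (longestIn A π S : ℝ) = n.factorial * meanLongest A S.card := by
  have := sum_longestIn_mul hA S (fun _ => 1) fun _ _ => rfl
  simpa [Fintype.card_perm, mul_comm] using this

/-- The positions in `I` at which the entry of `π` belongs to `V`. -/
def box {n : ℕ} (I V : Finset (Fin n)) (π : Equiv.Perm (Fin n)) : Finset (Fin n) :=
  I.filter fun i => π i ∈ V

theorem box_mul_extendPerm {n : ℕ} (I V : Finset (Fin n)) (π : Equiv.Perm (Fin n))
    {S : Finset (Fin n)} (ρ : Equiv.Perm (Fin S.card)) (h : box I V π = S) :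
    box I V (π * extendPerm S ρ) = S := by
  ext i
  by_cases hi : i ∈ S
  · have h1 : extendPerm S ρ i ∈ S := (extendPerm_mem_iff ρ).2 hi
    refine iff_of_true ?_ hi
    have h2 : extendPerm S ρ i ∈ box I V π := by rw [h]; exact h1
    have h3 : i ∈ box I V π := by rw [h]; exact hi
    exact Finset.mem_filter.2 ⟨(Finset.mem_filter.1 h3).1, (Finset.mem_filter.1 h2).2⟩
  · refine iff_of_false (fun h1 => hi ?_) hi
    rw [box, Finset.mem_filter, Equiv.Perm.mul_apply, extendPerm_of_notMem ρ hi] at h1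
    rw [← h]
    exact Finset.mem_filter.2 h1

theorem extendPerm_inv {n : ℕ} (S : Finset (Fin n)) (ρ : Equiv.Perm (Fin S.card)) :
    (extendPerm S ρ)⁻¹ = extendPerm S ρ⁻¹ := by
  simp [extendPerm, Equiv.Perm.extendDomain_inv]

/-- Rearranging the entries on `S` only moves values of `V` among positions of `S`. Hence the event
that the box equals `S` has the invariance required by `sum_pat_mul`. -/
theorem box_mul_extendPerm_eq_iff {n : ℕ} (I V : Finset (Fin n)) (π : Equiv.Perm (Fin n))
    (S : Finset (Fin n)) (ρ : Equiv.Perm (Fin S.card)) :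
    box I V (π * extendPerm S ρ) = S ↔ box I V π = S := by
  refine ⟨fun h => ?_, box_mul_extendPerm I V π ρ⟩
  have := box_mul_extendPerm I V _ ρ⁻¹ h
  rwa [← extendPerm_inv, mul_inv_cancel_right] at this

/-- Conditionally on which positions the box contains, the pattern there is uniform, so only the
size of the box matters. -/
theorem sum_longestIn_box {A : Set FinPerm} (hA : (⟨0, 1⟩ : FinPerm) ∈ A) {n : ℕ}
    (I V : Finset (Fin n)) :
    ∑ π, (longestIn A π (box I V π) : ℝ) = ∑ π, meanLongest A (box I V π).card := by
  have h1 : ∀ π, (longestIn A π (box I V π) : ℝ) =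
      ∑ S, (longestIn A π S : ℝ) * if box I V π = S then 1 else 0 := fun π => by simp
  have h2 : ∀ π, meanLongest A (box I V π).card =
      ∑ S : Finset (Fin n), meanLongest A S.card * if box I V π = S then 1 else 0 :=
    fun π => by simp
  simp only [h1, h2]
  rw [Finset.sum_comm]
  conv_rhs => rw [Finset.sum_comm]
  refine Finset.sum_congr rfl fun S _ => ?_
  rw [← Finset.mul_sum]
  exact sum_longestIn_mul hA S _ fun π ρ => by simp only [box_mul_extendPerm_eq_iff]

theorem card_filter_apply_eq {n : ℕ} (i v : Fin n) :
    n * (Finset.univ.filter fun π : Equiv.Perm (Fin n) => π i = v).card = n.factorial := by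
  have h : ∀ w, (Finset.univ.filter fun π : Equiv.Perm (Fin n) => π i = w).card =
      (Finset.univ.filter fun π : Equiv.Perm (Fin n) => π i = v).card := fun w => by
    refine Finset.card_equiv (Equiv.mulLeft (Equiv.swap w v)) fun π => ?_
    simp only [Finset.mem_filter, Finset.mem_univ, true_and, Equiv.coe_mulLeft,
      Equiv.Perm.mul_apply]
    constructor
    · rintro rfl
      simp
    · intro h
      simpa using congrArg (Equiv.swap w v) h
  have := Finset.card_eq_sum_card_fiberwise (s := Finset.univ) (t := Finset.univ)
    (f := fun π : Equiv.Perm (Fin n) => π i) (fun _ _ => Finset.mem_coe.2 (Finset.mem_univ _))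
  simp only [h] at this
  simpa [Fintype.card_perm] using this.symm

theorem sum_card_box {n : ℕ} (I V : Finset (Fin n)) :
    n * ∑ π, (box I V π).card = I.card * V.card * n.factorial := by
  have h : ∀ π : Equiv.Perm (Fin n), (box I V π).card =
      ∑ i ∈ I, ∑ v ∈ V, if π i = v then 1 else 0 := fun π => by
    rw [box, Finset.card_filter]
    exact Finset.sum_congr rfl fun i _ => by simp
  simp only [h]
  rw [Finset.sum_comm, Finset.mul_sum]
  have h2 : ∀ i ∈ I, n * ∑ π : Equiv.Perm (Fin n), ∑ v ∈ V, (if π i = v then 1 else 0) =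
      V.card * n.factorial := fun i _ => by
    rw [Finset.sum_comm, Finset.mul_sum]
    simp_rw [← Finset.card_filter, card_filter_apply_eq]
    simp
  rw [Finset.sum_congr rfl h2]
  simp [mul_assoc]

/-- Cauchy–Schwarz, that is, concavity of the square root, applied to the mean box size `I.card *
V.card / n`. -/
theorem sum_sqrt_card_box_le {n : ℕ} (hn : 0 < n) (I V : Finset (Fin n)) :
    ∑ π, √((box I V π).card : ℝ) ≤ n.factorial * √((I.card * V.card : ℝ) / n) := by
  have h1 := sq_sum_le_card_mul_sum_sq (s := (Finset.univ : Finset (Equiv.Perm (Fin n))))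
    (f := fun π => √((box I V π).card : ℝ))
  simp only [Real.sq_sqrt (Nat.cast_nonneg _), Finset.card_univ, Fintype.card_perm,
    Fintype.card_fin] at h1
  have h2 : (n : ℝ) * ∑ π, ((box I V π).card : ℝ) = I.card * V.card * n.factorial := by
    exact_mod_cast sum_card_box I V
  have hn' : (0 : ℝ) < n := by exact_mod_cast hn
  refine abs_le_of_sq_le_sq' ?_ (by positivity) |>.2
  rw [mul_pow, Real.sq_sqrt (by positivity)]
  calc _ ≤ _ := h1
    _ = _ := by
      have : ∑ π, ((box I V π).card : ℝ) = I.card * V.card * n.factorial / n := by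
        rw [eq_div_iff hn'.ne', ← h2, mul_comm]
      rw [this]
      ring

theorem sum_longestIn_box_le {A : Set FinPerm} (hA : (⟨0, 1⟩ : FinPerm) ∈ A) {a C : ℝ}
    (ha : 0 ≤ a) (h : ∀ k, meanLongest A k ≤ a * √(k : ℝ) + C) {n : ℕ} (hn : 0 < n)
    (I V : Finset (Fin n)) :
    ∑ π, (longestIn A π (box I V π) : ℝ) ≤
      n.factorial * (a * √((I.card * V.card : ℝ) / n) + C) := by
  rw [sum_longestIn_box hA]
  calc _ ≤ ∑ π, (a * √((box I V π).card : ℝ) + C) := Finset.sum_le_sum fun π _ => h _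
    _ = a * ∑ π, √((box I V π).card : ℝ) + n.factorial * C := by
      rw [Finset.sum_add_distrib, ← Finset.mul_sum]
      simp [Fintype.card_perm]
    _ ≤ a * (n.factorial * √((I.card * V.card : ℝ) / n)) + n.factorial * C := by
      gcongr
      exact sum_sqrt_card_box_le hn I V
    _ = _ := by ring

/-! ### Counting permutations with prescribed patterns on complementary sets -/

theorem ncard_setOf_eq_sum {α : Type*} [Fintype α] (s : Set α) :
    (s.ncard : ℝ) = ∑ a, s.indicator (fun _ => (1 : ℝ)) a := by
  classical
  rw [Set.ncard_eq_toFinset_card']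
  simp [Set.indicator_apply]

theorem count_eq_sum (A : Set FinPerm) (n : ℕ) :
    (count A n : ℝ) =
      ∑ ρ : Equiv.Perm (Fin n), A.indicator (fun _ => (1 : ℝ)) (⟨n, ρ⟩ : FinPerm) := by
  rw [count, ncard_setOf_eq_sum]
  rfl

theorem pat_mul_extendPerm_compl {n : ℕ} (π : Equiv.Perm (Fin n)) {I J : Finset (Fin n)}
    (hIJ : Disjoint J I) (ρ : Equiv.Perm (Fin I.card)) :
    subPattern (π * extendPerm I ρ) J = subPattern π J :=
  subPattern_congr fun i hi => by
    rw [Equiv.Perm.mul_apply, extendPerm_of_notMem ρ (Finset.disjoint_left.1 hIJ hi)]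

/-- The patterns on `I` and on its complement are independent and uniform, so the count is `n!`
times `count A k / k!` times `count B (n - k) / (n - k)!`, where `k = I.card`. -/
theorem card_subPattern_mem_mem (A B : Set FinPerm) {n : ℕ} (I : Finset (Fin n)) :
    Set.ncard {π : Equiv.Perm (Fin n) | subPattern π I ∈ A ∧ subPattern π Iᶜ ∈ B} =
      n.choose I.card * (count A I.card * count B (n - I.card)) := by
  have hc : Iᶜ.card = n - I.card := by rw [Finset.card_compl, Fintype.card_fin]
  have h1 := sum_pat_mul I (fun ρ => A.indicator (fun _ => (1 : ℝ)) (⟨I.card, ρ⟩ : FinPerm))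
    (fun π => B.indicator (fun _ => (1 : ℝ)) (subPattern π Iᶜ)) fun π ρ => by
      simp only [pat_mul_extendPerm_compl π disjoint_compl_left ρ]
  have h2 := sum_pat_mul Iᶜ (fun ρ => B.indicator (fun _ => (1 : ℝ)) (⟨Iᶜ.card, ρ⟩ : FinPerm))
    (fun _ => 1) fun _ _ => rfl
  rw [← count_eq_sum] at h1 h2
  simp only [← subPattern_def, mul_one, Finset.sum_const, Finset.card_univ, Fintype.card_perm,
    Fintype.card_fin, nsmul_eq_mul] at h1 h2
  have h3 : (Set.ncard {π : Equiv.Perm (Fin n) | subPattern π I ∈ A ∧ subPattern π Iᶜ ∈ B} : ℝ) =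
      ∑ π : Equiv.Perm (Fin n), A.indicator (fun _ => (1 : ℝ)) (subPattern π I) *
        B.indicator (fun _ => (1 : ℝ)) (subPattern π Iᶜ) := by
    rw [ncard_setOf_eq_sum]
    refine Finset.sum_congr rfl fun π _ => ?_
    by_cases h1 : subPattern π I ∈ A <;> by_cases h2 : subPattern π Iᶜ ∈ B <;>
      simp [h1, h2]
  rw [← h3] at h1
  rw [hc] at h2
  have hle : I.card ≤ n := by simpa using I.card_le_univ
  have h4 : (n.choose I.card * I.card.factorial * (n - I.card).factorial : ℝ) = n.factorial := by
    exact_mod_cast Nat.choose_mul_factorial_mul_factorial hle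
  have p1 : (0 : ℝ) < I.card.factorial := by exact_mod_cast Nat.factorial_pos _
  have p2 : (0 : ℝ) < (n - I.card).factorial := by exact_mod_cast Nat.factorial_pos _
  have : (Set.ncard {π : Equiv.Perm (Fin n) | subPattern π I ∈ A ∧ subPattern π Iᶜ ∈ B} : ℝ) =
      n.choose I.card * (count A I.card * count B (n - I.card)) := by
    apply mul_left_cancel₀ p1.ne'
    apply mul_left_cancel₀ p2.ne'
    rw [h1, mul_left_comm, h2, ← h4]
    ring
  exact_mod_cast this

/-! ### A variance inequality on the symmetric group -/

theorem decomposeFin_symm_mul_swap {n : ℕ} (p : Fin (n + 1)) (e : Equiv.Perm (Fin n))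
    (i j : Fin n) :
    Equiv.Perm.decomposeFin.symm (p, e * Equiv.swap i j) =
      Equiv.Perm.decomposeFin.symm (p, e) * Equiv.swap i.succ j.succ := by
  ext x
  congr 1
  induction x using Fin.cases with
  | zero =>
    rw [Equiv.Perm.mul_apply, Equiv.swap_apply_of_ne_of_ne (Fin.succ_ne_zero i).symm
      (Fin.succ_ne_zero j).symm, Equiv.Perm.decomposeFin_symm_apply_zero,
      Equiv.Perm.decomposeFin_symm_apply_zero]
  | succ x =>
    rw [Equiv.Perm.mul_apply, ← (Fin.succ_injective n).map_swap,
      Equiv.Perm.decomposeFin_symm_apply_succ, Equiv.Perm.decomposeFin_symm_apply_succ,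
      Equiv.Perm.mul_apply]

theorem sum_filter_apply_zero {n : ℕ} (f : Equiv.Perm (Fin (n + 1)) → ℝ) (p : Fin (n + 1)) :
    ∑ π with π 0 = p, f π = ∑ e : Equiv.Perm (Fin n), f (Equiv.Perm.decomposeFin.symm (p, e)) := by
  rw [Finset.sum_filter, ← Equiv.sum_comp Equiv.Perm.decomposeFin.symm, Fintype.sum_prod_type]
  simp only [Equiv.Perm.decomposeFin_symm_apply_zero]
  rw [Finset.sum_comm]
  simp

/-- The sum of the squares of the changes of `f` caused by exchanging the entries at positions
`i` and `j`. -/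
def swapEnergy {n : ℕ} (f : Equiv.Perm (Fin n) → ℝ) (i j : Fin n) : ℝ :=
  ∑ π, (f π - f (π * Equiv.swap i j)) ^ 2

theorem card_filter_apply_zero (n : ℕ) (p : Fin (n + 1)) :
    (Finset.univ.filter fun π : Equiv.Perm (Fin (n + 1)) => π 0 = p).card = n.factorial := by
  have := card_filter_apply_eq (0 : Fin (n + 1)) p
  rw [Nat.factorial_succ] at this
  exact Nat.eq_of_mul_eq_mul_left (Nat.succ_pos n) this

/-- Controls the part of the variance explained by the first entry. Exchanging the values `p` and
`q` maps the fibre over `p` onto the fibre over `q`, and on that fibre it is an exchange of position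
`0` with the position of `q`. -/
theorem sum_sub_sq_le_swapEnergy {n : ℕ} (f : Equiv.Perm (Fin (n + 1)) → ℝ) :
    ∑ p, ∑ q, ((∑ π with π 0 = p, f π) - ∑ π with π 0 = q, f π) ^ 2 ≤
      n.factorial * ∑ j, swapEnergy f 0 j := by
  have h1 : ∀ p q : Fin (n + 1), (∑ π with π 0 = q, f π) =
      ∑ π with π 0 = p, f (Equiv.swap p q * π) := fun p q => by
    symm
    refine Finset.sum_equiv (Equiv.mulLeft (Equiv.swap p q)) (fun π => ?_) fun π _ => rfl
    simp only [Finset.mem_filter, Finset.mem_univ, true_and, Equiv.coe_mulLeft,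
      Equiv.Perm.mul_apply]
    constructor
    · rintro rfl
      simp
    · intro h
      simpa using congrArg (Equiv.swap p q) h
  have h2 : ∀ p q : Fin (n + 1), ((∑ π with π 0 = p, f π) - ∑ π with π 0 = q, f π) ^ 2 ≤
      n.factorial * ∑ π with π 0 = p, (f π - f (Equiv.swap p q * π)) ^ 2 := fun p q => by
    rw [h1 p q, ← Finset.sum_sub_distrib, ← card_filter_apply_zero n p]
    exact sq_sum_le_card_mul_sum_sq
  calc _ ≤ ∑ p : Fin (n + 1), ∑ q : Fin (n + 1),
        (n.factorial : ℝ) * ∑ π with π 0 = p, (f π - f (Equiv.swap p q * π)) ^ 2 :=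
        Finset.sum_le_sum fun p _ => Finset.sum_le_sum fun q _ => h2 p q
    _ = n.factorial * ∑ π : Equiv.Perm (Fin (n + 1)),
        ∑ q, (f π - f (Equiv.swap (π 0) q * π)) ^ 2 := by
      simp only [← Finset.mul_sum]
      congr 1
      rw [← Finset.sum_fiberwise (s := Finset.univ)
        (g := fun π : Equiv.Perm (Fin (n + 1)) => π 0)]
      refine Finset.sum_congr rfl fun p _ => ?_
      rw [Finset.sum_comm]
      refine Finset.sum_congr rfl fun π hπ => ?_
      rw [(Finset.mem_filter.1 hπ).2]
    _ = _ := by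
      congr 1
      simp only [swapEnergy]
      rw [Finset.sum_comm (s := (Finset.univ : Finset (Fin (n + 1))))]
      refine Finset.sum_congr rfl fun π _ => ?_
      rw [← Equiv.sum_comp π]
      exact Finset.sum_congr rfl fun j _ => by rw [← Equiv.mul_swap_eq_swap_mul]

theorem sum_sub_sq_eq {n : ℕ} (a : Fin n → ℝ) :
    ∑ p, ∑ q, (a p - a q) ^ 2 = 2 * (n * ∑ p, a p ^ 2 - (∑ p, a p) ^ 2) := by
  simp only [sub_sq, Finset.sum_add_distrib, Finset.sum_sub_distrib, Finset.sum_const,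
    Finset.card_univ, Fintype.card_fin, nsmul_eq_mul, ← Finset.mul_sum, ← Finset.sum_mul]
  simp only [mul_assoc]
  ring

/-- Induction by the law of total variance, revealing one entry at a time. The spread between the
fibres of the first entry is the term `k = 0`; the spread inside the fibres is the inductive
hypothesis, since exchanges of later positions respect the fibres. -/
theorem variance_le_swapEnergy : ∀ {n : ℕ} (f : Equiv.Perm (Fin n) → ℝ),
    n.factorial * ∑ π, f π ^ 2 - (∑ π, f π) ^ 2 ≤
      n.factorial / 2 * ∑ k : Fin n, (1 / ((n : ℝ) - k)) * ∑ j with k ≤ j, swapEnergy f k j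
  | 0, f => by simp
  | n + 1, f => by
    set F : Fin (n + 1) → Equiv.Perm (Fin n) → ℝ :=
      fun p e => f (Equiv.Perm.decomposeFin.symm (p, e)) with hF
    have hsum : ∀ g : Equiv.Perm (Fin (n + 1)) → ℝ, ∑ π, g π =
        ∑ p, ∑ e, g (Equiv.Perm.decomposeFin.symm (p, e)) := fun g => by
      rw [← Equiv.sum_comp Equiv.Perm.decomposeFin.symm, Fintype.sum_prod_type]
    have ih : ∀ p, n.factorial * ∑ e, F p e ^ 2 - (∑ e, F p e) ^ 2 ≤
      n.factorial / 2 * ∑ k : Fin n, (1 / ((n : ℝ) - k)) * ∑ j with k ≤ j, swapEnergy (F p) k j :=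
      fun p => variance_le_swapEnergy (F p)
    have hD : ∀ k j : Fin n, swapEnergy f k.succ j.succ = ∑ p, swapEnergy (F p) k j :=
      fun k j => by
        simp only [swapEnergy, hF, decomposeFin_symm_mul_swap]
        rw [hsum]
    have h0 := sum_sub_sq_le_swapEnergy f
    simp only [sum_filter_apply_zero] at h0
    rw [sum_sub_sq_eq] at h0
    have hW : ∑ k : Fin (n + 1), (1 / (((n + 1 : ℕ) : ℝ) - k)) *
          ∑ j with k ≤ j, swapEnergy f k j =
        1 / (n + 1) * ∑ j, swapEnergy f 0 j +
          ∑ p, ∑ k : Fin n, (1 / ((n : ℝ) - k)) * ∑ j with k ≤ j, swapEnergy (F p) k j := by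
      rw [Fin.sum_univ_succ]
      congr 1
      · simp
      · rw [Finset.sum_comm]
        refine Finset.sum_congr rfl fun k _ => ?_
        rw [← Finset.mul_sum, Finset.sum_comm]
        congr 1
        · simp
        · rw [Finset.sum_filter, Fin.sum_univ_succ, Finset.sum_filter]
          simp [hD]
    have h1 := Finset.sum_le_sum fun p (_ : p ∈ Finset.univ) => ih p
    rw [Finset.sum_sub_distrib, ← Finset.mul_sum, ← Finset.mul_sum] at h1
    rw [hW, hsum, hsum, Nat.factorial_succ]
    push_cast at h0 ⊢
    have h2 := mul_le_mul_of_nonneg_left h1 (by positivity : (0 : ℝ) ≤ n + 1)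
    have h3 : ((n : ℝ) + 1) * n.factorial / 2 * (1 / (n + 1) * ∑ j, swapEnergy f 0 j) =
        n.factorial / 2 * ∑ j, swapEnergy f 0 j := by
      field_simp
    rw [mul_add, h3]
    simp only [hF] at h2 h0 ⊢
    linarith

/-- The one-sided bound, used at `π` and at the exchanged permutation, controls the change in both
directions. The right side takes only the values 0, 1 and 2, so its square is at most twice itself;
this keeps the final bound linear in the indicators. -/
theorem swapEnergy_le {n : ℕ} {f : Equiv.Perm (Fin n) → ℝ}
    {J : Equiv.Perm (Fin n) → Finset (Fin n)} {i j : Fin n}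
    (h : ∀ π, f π - f (π * Equiv.swap i j) ≤
      (if i ∈ J π then 1 else 0) + if j ∈ J π then 1 else 0) :
    swapEnergy f i j ≤
      4 * ∑ π, ((if i ∈ J π then (1 : ℝ) else 0) + if j ∈ J π then 1 else 0) := by
  set u : Equiv.Perm (Fin n) → ℝ :=
    fun π => (if i ∈ J π then (1 : ℝ) else 0) + if j ∈ J π then 1 else 0 with hu
  have h0 : ∀ π, 0 ≤ u π := fun π => by
    simp only [hu]; split_ifs <;> norm_num
  have h2 : ∀ π, u π ^ 2 ≤ 2 * u π := fun π => by
    simp only [hu]; split_ifs <;> norm_num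
  have h1 : ∀ π, (f π - f (π * Equiv.swap i j)) ^ 2 ≤
      2 * u π + 2 * u (π * Equiv.swap i j) := fun π => by
    have a := h π
    have b := h (π * Equiv.swap i j)
    rw [mul_assoc, Equiv.swap_mul_self, mul_one] at b
    change _ ≤ u π at a
    change _ ≤ u (π * Equiv.swap i j) at b
    have c := h2 π
    have d := h2 (π * Equiv.swap i j)
    have e := h0 π
    have g := h0 (π * Equiv.swap i j)
    rcases le_total 0 (f π - f (π * Equiv.swap i j)) with hs | hs
    · nlinarith
    · nlinarith
  calc swapEnergy f i j ≤ ∑ π, (2 * u π + 2 * u (π * Equiv.swap i j)) :=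
        Finset.sum_le_sum fun π _ => h1 π
    _ = 4 * ∑ π, u π := by
      rw [Finset.sum_add_distrib, ← Finset.mul_sum, ← Finset.mul_sum,
        Equiv.sum_comp (Equiv.mulRight (Equiv.swap i j)) u |>.symm]
      simp only [Equiv.coe_mulRight]
      rw [← Equiv.sum_comp (Equiv.mulRight (Equiv.swap i j)) fun π => u (π * Equiv.swap i j)]
      simp only [Equiv.coe_mulRight, mul_assoc, Equiv.swap_mul_self, mul_one]
      rw [← Equiv.sum_comp (Equiv.mulRight (Equiv.swap i j)) u]
      simp only [Equiv.coe_mulRight]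
      ring

theorem sum_one_div_sub_eq_harmonic (n : ℕ) :
    ∑ k : Fin n, 1 / ((n : ℝ) - k) = (harmonic n : ℝ) := by
  rw [Fin.sum_univ_eq_sum_range (fun k => 1 / ((n : ℝ) - k)), ← Finset.sum_range_reflect,
    harmonic, Rat.cast_sum]
  refine Finset.sum_congr rfl fun k hk => ?_
  have := Finset.mem_range.1 hk
  rw [show n - 1 - k = n - (k + 1) by omega, Nat.cast_sub (by omega)]
  push_cast
  ring

/-- The indicators of membership in `J π` add up to `f π`, which turns the energy bound into a
multiple of the mean. Terms attached to `k` lose their weight `1 / (n - k)` to the number of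
partners `j`; terms attached to `j` collect the weights into a harmonic number. -/
theorem variance_le {n : ℕ} {f : Equiv.Perm (Fin n) → ℝ}
    {J : Equiv.Perm (Fin n) → Finset (Fin n)} (hJ : ∀ π, ((J π).card : ℝ) = f π)
    (h : ∀ π i j, f π - f (π * Equiv.swap i j) ≤
      (if i ∈ J π then 1 else 0) + if j ∈ J π then 1 else 0) :
    n.factorial * ∑ π, f π ^ 2 - (∑ π, f π) ^ 2 ≤
      n.factorial * (2 * (1 + harmonic n) * ∑ π, f π) := by
  set a : Fin n → ℝ := fun i => ∑ π, if i ∈ J π then (1 : ℝ) else 0 with ha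
  have ha0 : ∀ i, 0 ≤ a i := fun i => Finset.sum_nonneg fun π _ => by split_ifs <;> norm_num
  have hasum : ∑ i, a i = ∑ π, f π := by
    simp only [ha]
    rw [Finset.sum_comm]
    exact Finset.sum_congr rfl fun π _ => by simp [← hJ]
  have hE : ∀ i j, swapEnergy f i j ≤ 4 * (a i + a j) := fun i j => by
    have := swapEnergy_le fun π => h π i j
    rwa [Finset.sum_add_distrib] at this
  have hk : ∀ k : Fin n, (0 : ℝ) < n - k := fun k => by
    have : (k : ℝ) < n := by exact_mod_cast k.2
    linarith
  have hW : ∑ k : Fin n, (1 / ((n : ℝ) - k)) * ∑ j with k ≤ j, swapEnergy f k j ≤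
      4 * ((1 + harmonic n) * ∑ π, f π) := by
    calc _ ≤ ∑ k : Fin n, (4 * a k + 1 / ((n : ℝ) - k) * (4 * ∑ j, a j)) := by
          refine Finset.sum_le_sum fun k _ => ?_
          have h1 : ∑ j with k ≤ j, swapEnergy f k j ≤ (n - k) * (4 * a k) + 4 * ∑ j, a j := by
            calc _ ≤ ∑ j with k ≤ j, (4 * a k + 4 * a j) :=
                  Finset.sum_le_sum fun j _ => (hE k j).trans_eq (mul_add _ _ _)
              _ = (n - k) * (4 * a k) + 4 * ∑ j with k ≤ j, a j := by
                rw [Finset.sum_add_distrib, Finset.sum_const, nsmul_eq_mul, ← Finset.mul_sum]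
                have : (Finset.univ.filter fun j : Fin n => k ≤ j).card = n - k := by
                  rw [← Fin.card_Ici k]
                  congr 1
                  ext; simp
                rw [this, Nat.cast_sub k.2.le]
              _ ≤ _ := by
                have := Finset.sum_le_sum_of_subset_of_nonneg
                  (Finset.filter_subset (k ≤ ·) Finset.univ) fun j _ _ => ha0 j
                linarith
          calc _ ≤ 1 / ((n : ℝ) - k) * ((n - k) * (4 * a k) + 4 * ∑ j, a j) :=
                mul_le_mul_of_nonneg_left h1 (one_div_nonneg.2 (hk k).le)
            _ = _ := by
              have := (hk k).ne'
              field_simp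
      _ = _ := by
        rw [Finset.sum_add_distrib, ← Finset.mul_sum, ← Finset.sum_mul,
          sum_one_div_sub_eq_harmonic, hasum]
        ring
  calc _ ≤ _ := variance_le_swapEnergy f
    _ ≤ n.factorial / 2 * (4 * ((1 + harmonic n) * ∑ π, f π)) := by gcongr
    _ = _ := by ring

theorem sum_abs_sub_mean_le {n : ℕ} {f : Equiv.Perm (Fin n) → ℝ}
    {J : Equiv.Perm (Fin n) → Finset (Fin n)} (hJ : ∀ π, ((J π).card : ℝ) = f π)
    (h : ∀ π i j, f π - f (π * Equiv.swap i j) ≤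
      (if i ∈ J π then 1 else 0) + if j ∈ J π then 1 else 0) :
    ∑ π, |f π - (∑ τ, f τ) / n.factorial| ≤
      n.factorial * √(2 * (1 + harmonic n) * ((∑ τ, f τ) / n.factorial)) := by
  have hN : (0 : ℝ) < n.factorial := by exact_mod_cast Nat.factorial_pos n
  have h0 : 0 ≤ ∑ τ, f τ := Finset.sum_nonneg fun π _ => by rw [← hJ]; positivity
  have hH : (0 : ℝ) ≤ harmonic n := by
    rw [harmonic]; push_cast; positivity
  have hv := variance_le hJ h
  set m := (∑ τ, f τ) / n.factorial with hm
  have hm' : ∑ τ, f τ = n.factorial * m := by rw [hm]; field_simp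
  have hm0 : 0 ≤ m := by positivity
  have h1 := sq_sum_le_card_mul_sum_sq (s := (Finset.univ : Finset (Equiv.Perm (Fin n))))
    (f := fun π => |f π - m|)
  simp only [sq_abs, Finset.card_univ, Fintype.card_perm, Fintype.card_fin] at h1
  have h2 : ∑ π, (f π - m) ^ 2 = ∑ π, f π ^ 2 - n.factorial * m ^ 2 := by
    simp only [sub_sq, Finset.sum_add_distrib, Finset.sum_sub_distrib, ← Finset.sum_mul,
      ← Finset.mul_sum, hm', Finset.sum_const, Finset.card_univ, Fintype.card_perm,
      Fintype.card_fin, nsmul_eq_mul]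
    ring
  refine abs_le_of_sq_le_sq' ?_ (by positivity) |>.2
  rw [mul_pow, Real.sq_sqrt (by positivity)]
  rw [hm'] at hv
  calc _ ≤ _ := h1
    _ = n.factorial * ∑ π, f π ^ 2 - (n.factorial * m) ^ 2 := by rw [h2]; ring
    _ ≤ _ := hv
    _ = _ := by ring

/-! ### Concentration of the longest subsequence in a box -/

/-- Deleting positions `i` and `j` from an optimal `J` leaves a subsequence untouched by the
exchange, and heredity keeps its pattern in `A`. -/
theorem longestIn_box_sub_le {A : Set FinPerm} (hA : Hereditary A) {n : ℕ} {I V : Finset (Fin n)}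
    {π : Equiv.Perm (Fin n)} {J : Finset (Fin n)} (hJ : J ⊆ box I V π)
    (hJA : subPattern π J ∈ A) (hc : J.card = longestIn A π (box I V π)) (i j : Fin n) :
    (longestIn A π (box I V π) : ℝ) - longestIn A (π * Equiv.swap i j)
        (box I V (π * Equiv.swap i j)) ≤
      (if i ∈ J then 1 else 0) + if j ∈ J then 1 else 0 := by
  have hfix : ∀ x ∈ (J.erase i).erase j, (π * Equiv.swap i j) x = π x := fun x hx => by
    have h1 := Finset.ne_of_mem_erase hx
    have h2 := Finset.ne_of_mem_erase (Finset.mem_of_mem_erase hx)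
    rw [Equiv.Perm.mul_apply, Equiv.swap_apply_of_ne_of_ne h2 h1]
  have hsub : (J.erase i).erase j ⊆ J := (Finset.erase_subset _ _).trans (Finset.erase_subset _ _)
  have h1 : (J.erase i).erase j ⊆ box I V (π * Equiv.swap i j) := fun x hx => by
    have := Finset.mem_filter.1 (hJ (hsub hx))
    exact Finset.mem_filter.2 ⟨this.1, by rw [hfix x hx]; exact this.2⟩
  have h2 : subPattern (π * Equiv.swap i j) ((J.erase i).erase j) ∈ A := by
    rw [subPattern_congr hfix]
    exact hA.subPattern_mem hsub hJA
  have h3 := le_longestIn h1 h2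
  have h4 : J.card ≤ ((J.erase i).erase j).card + (if i ∈ J then 1 else 0) +
      if j ∈ J then 1 else 0 := by
    have a : J.card ≤ (J.erase i).card + if i ∈ J then 1 else 0 := by
      split_ifs with hi
      · rw [Finset.card_erase_add_one hi]
      · rw [Finset.erase_eq_of_notMem hi, add_zero]
    have b : (J.erase i).card ≤ ((J.erase i).erase j).card + if j ∈ J then 1 else 0 := by
      split_ifs with hj
      · have := Finset.pred_card_le_card_erase (s := J.erase i) (a := j)
        omega
      · rw [Finset.erase_eq_of_notMem fun h => hj (Finset.mem_of_mem_erase h), add_zero]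
    omega
  have h5 : (longestIn A π (box I V π) : ℝ) ≤ longestIn A (π * Equiv.swap i j)
      (box I V (π * Equiv.swap i j)) + (if i ∈ J then 1 else 0) + if j ∈ J then 1 else 0 := by
    rw [← hc]
    have := h4.trans (Nat.add_le_add_right (Nat.add_le_add_right h3 _) _)
    exact_mod_cast this
  linarith

theorem longestIn_mono {A : Set FinPerm} {n : ℕ} {π : Equiv.Perm (Fin n)} {S T : Finset (Fin n)}
    (hST : S ⊆ T) : longestIn A π S ≤ longestIn A π T := by
  classical
  unfold longestIn
  exact Finset.sup_mono (Finset.filter_subset_filter _ (Finset.powerset_mono.2 hST))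

theorem meanLongest_nonneg (A : Set FinPerm) (n : ℕ) : 0 ≤ meanLongest A n := by
  unfold meanLongest
  positivity

/-- A bound for the mean absolute deviation of the length of the longest subsequence with pattern
in `A` within any box. -/
noncomputable def deviation (A : Set FinPerm) (n : ℕ) : ℝ :=
  √(2 * (1 + harmonic n) * meanLongest A n)

/-- The bound is uniform over boxes because the mean within a box is at most the mean for the whole
word. -/
theorem sum_abs_longestIn_box_sub_le {A : Set FinPerm} (hA : Hereditary A)
    (h0 : (⟨0, 1⟩ : FinPerm) ∈ A) {n : ℕ} (I V : Finset (Fin n)) :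
    ∑ π, |(longestIn A π (box I V π) : ℝ) -
        (∑ τ, (longestIn A τ (box I V τ) : ℝ)) / n.factorial| ≤ n.factorial * deviation A n := by
  choose J hJ hJA hc using fun π : Equiv.Perm (Fin n) =>
    exists_card_eq_longestIn h0 π (box I V π)
  have hH : (0 : ℝ) ≤ harmonic n := by
    rw [harmonic]; push_cast; positivity
  refine (sum_abs_sub_mean_le (J := J) (fun π => by rw [hc]) fun π i j =>
    longestIn_box_sub_le hA (hJ π) (hJA π) (hc π) i j).trans ?_
  unfold deviation meanLongest
  gcongr with π
  rw [longest_eq_longestIn]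
  exact longestIn_mono (Finset.subset_univ _)

/-! ### Growth rates from exponential bounds -/

theorem eventually_mul_pow_le_pow (C : ℝ) (d : ℕ) {r : ℝ} (hr : 1 < r) :
    ∀ᶠ n : ℕ in atTop, C * ((n : ℝ) + 1) ^ d ≤ r ^ n := by
  have h1 := (tendsto_pow_const_div_const_pow_of_one_lt d hr).comp (tendsto_add_atTop_nat 1)
  have h2 := (h1.const_mul (C * r)).eventually_lt_const (u := 1) (by simp)
  filter_upwards [h2] with n hn
  have hr0 : 0 < r := one_pos.trans hr
  simp only [Function.comp, Nat.cast_add, Nat.cast_one] at hn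
  rw [← mul_div_assoc, div_lt_one (by positivity), pow_succ] at hn
  nlinarith

/-- Polynomial factors are absorbed by moving `t` slightly towards the target, so bounds up to such
factors determine the limit of the roots. -/
theorem tendsto_root_of_bounds {u : ℕ → ℝ} (hu : ∀ n, 0 ≤ u n) {s : ℝ}
    (hup : ∀ t, s < t → 0 < t → ∃ (C : ℝ) (d : ℕ), ∀ n, u n ≤ C * ((n : ℝ) + 1) ^ d * t ^ n)
    (hlow : ∀ t, 0 < t → t < s →
      ∃ (δ : ℝ) (d : ℕ), 0 < δ ∧ ∀ n, δ * t ^ n ≤ u n * ((n : ℝ) + 1) ^ d) (hs : 0 ≤ s) :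
    Tendsto (fun n : ℕ => u n ^ (1 / (n : ℝ))) atTop (𝓝 s) := by
  refine tendsto_order.2 ⟨fun a ha => ?_, fun a ha => ?_⟩
  · rcases lt_or_ge a 0 with ha0 | ha0
    · exact Eventually.of_forall fun n => ha0.trans_le (Real.rpow_nonneg (hu n) _)
    obtain ⟨t', h1, h2⟩ := exists_between ha
    obtain ⟨t, h3, h4⟩ := exists_between h2
    have ht' : 0 < t' := ha0.trans_lt h1
    obtain ⟨δ, d, hδ, h⟩ := hlow t (ht'.trans h3) h4
    filter_upwards [eventually_mul_pow_le_pow δ⁻¹ d ((one_lt_div ht').2 h3),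
      eventually_gt_atTop 0] with n hn hn0
    have h5 : t' ^ n ≤ u n := by
      rw [div_pow, le_div_iff₀ (by positivity), inv_mul_eq_div, div_mul_eq_mul_div,
        div_le_iff₀ hδ] at hn
      have h6 := h n
      have h7 : (0 : ℝ) < ((n : ℝ) + 1) ^ d := by positivity
      refine le_of_mul_le_mul_left ?_ h7
      linarith
    calc a < t' := h1
      _ = (t' ^ n) ^ (1 / (n : ℝ)) := by
        rw [one_div, Real.pow_rpow_inv_natCast ht'.le hn0.ne']
      _ ≤ _ := Real.rpow_le_rpow (by positivity) h5 (by positivity)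
  · obtain ⟨t', h1, h2⟩ := exists_between ha
    obtain ⟨t, h3, h4⟩ := exists_between h1
    have ht : 0 < t := hs.trans_lt h3
    have ht' : 0 < t' := ht.trans h4
    obtain ⟨C, d, h⟩ := hup t h3 ht
    filter_upwards [eventually_mul_pow_le_pow C d ((one_lt_div ht).2 h4),
      eventually_gt_atTop 0] with n hn hn0
    have h5 : u n ≤ t' ^ n := by
      rw [div_pow, le_div_iff₀ (by positivity)] at hn
      exact (h n).trans hn
    calc _ ≤ (t' ^ n) ^ (1 / (n : ℝ)) := Real.rpow_le_rpow (hu n) h5 (by positivity)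
      _ = t' := by rw [one_div, Real.pow_rpow_inv_natCast ht'.le hn0.ne']
      _ < a := h2

theorem exists_forall_le_mul_pow {u : ℕ → ℝ} (hu : ∀ n, 0 ≤ u n) {s t : ℝ}
    (h : Tendsto (fun n : ℕ => u n ^ (1 / (n : ℝ))) atTop (𝓝 s)) (hst : s < t) (ht : 0 < t) :
    ∃ C, 0 < C ∧ ∀ n, u n ≤ C * t ^ n := by
  obtain ⟨N, hN⟩ := eventually_atTop.1 ((h.eventually_lt_const hst).and (eventually_gt_atTop 0))
  have hpos : ∀ n, 0 ≤ u n / t ^ n := fun n => div_nonneg (hu n) (by positivity)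
  refine ⟨1 + ∑ n ∈ Finset.range N, u n / t ^ n,
    add_pos_of_pos_of_nonneg one_pos (Finset.sum_nonneg fun n _ => hpos n), fun n => ?_⟩
  rw [← div_le_iff₀ (by positivity)]
  rcases lt_or_ge n N with hn | hn
  · exact (Finset.single_le_sum (fun n _ => hpos n) (Finset.mem_range.2 hn)).trans
      (le_add_of_nonneg_left zero_le_one)
  · refine le_trans ?_ (le_add_of_nonneg_right (Finset.sum_nonneg fun n _ => hpos n))
    rw [div_le_one (by positivity)]
    obtain ⟨h1, h2⟩ := hN n hn
    calc u n = (u n ^ (1 / (n : ℝ))) ^ n := by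
          rw [one_div, Real.rpow_inv_natCast_pow (hu n) h2.ne']
      _ ≤ t ^ n := pow_le_pow_left₀ (Real.rpow_nonneg (hu n) _) h1.le n

theorem count_zero {A : Set FinPerm} (h0 : (⟨0, 1⟩ : FinPerm) ∈ A) : count A 0 = 1 := by
  rw [count, Set.ncard_eq_one]
  refine ⟨1, ?_⟩
  ext π
  rw [Subsingleton.elim π 1]
  simp [h0]

theorem Hereditary.count_pos_of_le {A : Set FinPerm} (hA : Hereditary A) {k n : ℕ} (hkn : k ≤ n)
    (hn : 0 < count A n) : 0 < count A k := by
  rw [count, Set.ncard_pos] at *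
  obtain ⟨π, hπ⟩ := hn
  obtain ⟨I, -, hI⟩ := Finset.exists_subset_card_eq (s := (Finset.univ : Finset (Fin n)))
    (n := k) (by simpa using hkn)
  subst hI
  exact ⟨pat π I, hA π I hπ⟩

/-- Eventual domination extends to all `n` because heredity rules out zero counts at small lengths.
The case `t = 0` is allowed for classes of growth rate zero; there `0 ^ 0 = 1` matches the single
empty permutation. -/
theorem Hereditary.exists_forall_mul_pow_le {A : Set FinPerm} (hA : Hereditary A)
    (h0 : (⟨0, 1⟩ : FinPerm) ∈ A) {s t : ℝ}
    (h : Tendsto (fun n : ℕ => (count A n : ℝ) ^ (1 / (n : ℝ))) atTop (𝓝 s))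
    (ht0 : 0 ≤ t) (ht : t < s ∨ t = 0) :
    ∃ δ, 0 < δ ∧ ∀ n, δ * t ^ n ≤ count A n := by
  rcases ht0.eq_or_lt with rfl | ht0
  · refine ⟨1, one_pos, fun n => ?_⟩
    rcases n.eq_zero_or_pos with rfl | hn
    · simp [count_zero h0]
    · simp [hn.ne']
  have hts : t < s := ht.resolve_right ht0.ne'
  obtain ⟨N, hN⟩ := eventually_atTop.1 ((h.eventually_const_lt hts).and (eventually_gt_atTop 0))
  have hN' : ∀ n, N ≤ n → t ^ n ≤ count A n := fun n hn => by
    obtain ⟨h1, h2⟩ := hN n hn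
    calc t ^ n ≤ ((count A n : ℝ) ^ (1 / (n : ℝ))) ^ n := pow_le_pow_left₀ ht0.le h1.le n
      _ = _ := by rw [one_div, Real.rpow_inv_natCast_pow (Nat.cast_nonneg _) h2.ne']
  have hpos : ∀ n, 1 ≤ (count A n : ℝ) := fun n => by
    have h1 : (0 : ℝ) < count A (max n N) :=
      (pow_pos ht0 _).trans_le (hN' _ (le_max_right _ _))
    exact_mod_cast hA.count_pos_of_le (le_max_left n N) (by exact_mod_cast h1)
  have hS : 0 ≤ ∑ k ∈ Finset.range N, t ^ k := Finset.sum_nonneg fun k _ => by positivity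
  refine ⟨(1 + ∑ k ∈ Finset.range N, t ^ k)⁻¹, by positivity, fun n => ?_⟩
  rw [inv_mul_eq_div, div_le_iff₀ (by positivity)]
  rcases lt_or_ge n N with hn | hn
  · have h1 := Finset.single_le_sum (f := fun k => t ^ k) (fun k _ => (pow_pos ht0 k).le)
      (Finset.mem_range.2 hn)
    nlinarith [hpos n]
  · nlinarith [hN' n hn, hpos n]

/-! ### Counting juxtapositions, merges and direct sums -/

theorem count_mono {A B : Set FinPerm} (h : A ⊆ B) (n : ℕ) : count A n ≤ count B n :=
  Set.ncard_le_ncard (fun _ hπ => h hπ) (Set.toFinite _)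

theorem card_filter_val_lt {n k : ℕ} (hk : k ≤ n) :
    (Finset.univ.filter fun i : Fin n => (i : ℕ) < k).card = k := by
  rw [Fin.card_filter_val_lt, min_eq_right hk]

theorem filter_le_val_eq_compl (n k : ℕ) :
    (Finset.univ.filter fun i : Fin n => k ≤ (i : ℕ)) =
      (Finset.univ.filter fun i : Fin n => (i : ℕ) < k)ᶜ := by
  ext; simp

theorem card_juxt_at (A B : Set FinPerm) {n k : ℕ} (hk : k ≤ n) :
    Set.ncard {π : Equiv.Perm (Fin n) |
      subPattern π (Finset.univ.filter fun i : Fin n => (i : ℕ) < k) ∈ A ∧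
        subPattern π (Finset.univ.filter fun i : Fin n => k ≤ (i : ℕ)) ∈ B} =
      n.choose k * (count A k * count B (n - k)) := by
  have := card_subPattern_mem_mem A B (Finset.univ.filter fun i : Fin n => (i : ℕ) < k)
  rwa [← filter_le_val_eq_compl, card_filter_val_lt hk] at this

theorem count_juxt_le (A B : Set FinPerm) (n : ℕ) : count (juxt A B) n ≤
    ∑ k ∈ Finset.range (n + 1), n.choose k * (count A k * count B (n - k)) := by
  calc count (juxt A B) n ≤ Set.ncard (⋃ k ∈ Finset.range (n + 1), {π : Equiv.Perm (Fin n) |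
      subPattern π (Finset.univ.filter fun i : Fin n => (i : ℕ) < k) ∈ A ∧
        subPattern π (Finset.univ.filter fun i : Fin n => k ≤ (i : ℕ)) ∈ B}) := by
        refine Set.ncard_le_ncard (fun π hπ => ?_) (Set.toFinite _)
        obtain ⟨k, hk, h⟩ := mem_juxt_iff.1 hπ
        exact Set.mem_biUnion (Finset.mem_coe.2 (Finset.mem_range.2 (Nat.lt_succ_of_le hk))) h
    _ ≤ _ := Finset.set_ncard_biUnion_le _ _
    _ = _ := Finset.sum_congr rfl fun k hk =>
      card_juxt_at A B (Nat.lt_succ_iff.1 (Finset.mem_range.1 hk))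

theorem le_count_juxt (A B : Set FinPerm) (n : ℕ) :
    ∑ k ∈ Finset.range (n + 1), n.choose k * (count A k * count B (n - k)) ≤
      (n + 1) * count (juxt A B) n := by
  have := Finset.sum_le_card_nsmul (Finset.range (n + 1))
    (fun k => n.choose k * (count A k * count B (n - k))) (count (juxt A B) n) fun k hk => by
      have hk' := Nat.lt_succ_iff.1 (Finset.mem_range.1 hk)
      rw [← card_juxt_at A B hk']
      exact Set.ncard_le_ncard (fun π hπ => mem_juxt_iff.2 ⟨k, hk', hπ⟩) (Set.toFinite _)
  simpa using this

/-- One binomial coefficient chooses the positions and the other the values of the `A`-part. -/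
theorem sum_card_subPattern_mem_mem (A B : Set FinPerm) (n : ℕ) :
    ∑ I : Finset (Fin n),
        Set.ncard {π : Equiv.Perm (Fin n) | subPattern π I ∈ A ∧ subPattern π Iᶜ ∈ B} =
      ∑ k ∈ Finset.range (n + 1), n.choose k * (n.choose k * (count A k * count B (n - k))) := by
  simp only [card_subPattern_mem_mem]
  have := Finset.sum_powerset_apply_card
    (x := (Finset.univ : Finset (Fin n)))
    (fun k => n.choose k * (count A k * count B (n - k)))
  simpa using this

theorem count_merge_le (A B : Set FinPerm) (n : ℕ) : count (merge A B) n ≤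
    ∑ k ∈ Finset.range (n + 1), n.choose k * (n.choose k * (count A k * count B (n - k))) := by
  rw [← sum_card_subPattern_mem_mem]
  calc count (merge A B) n ≤ Set.ncard (⋃ I ∈ (Finset.univ : Finset (Finset (Fin n))),
      {π : Equiv.Perm (Fin n) | subPattern π I ∈ A ∧ subPattern π Iᶜ ∈ B}) := by
        refine Set.ncard_le_ncard (fun π hπ => ?_) (Set.toFinite _)
        obtain ⟨I, h⟩ := mem_merge_iff.1 hπ
        exact Set.mem_biUnion (Finset.mem_coe.2 (Finset.mem_univ I)) h
    _ ≤ _ := Finset.set_ncard_biUnion_le _ _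

theorem card_filter_card_le (n N : ℕ) :
    (Finset.univ.filter fun X : Finset (Fin n) => X.card ≤ N).card ≤ (N + 1) * (n + 1) ^ N := by
  calc _ ≤ ((Finset.range (N + 1)).biUnion fun i =>
          Finset.powersetCard i (Finset.univ : Finset (Fin n))).card := by
        refine Finset.card_le_card fun X hX => ?_
        rw [Finset.mem_biUnion]
        exact ⟨X.card, Finset.mem_range.2 (Nat.lt_succ_of_le (Finset.mem_filter.1 hX).2),
          Finset.mem_powersetCard.2 ⟨Finset.subset_univ X, rfl⟩⟩
    _ ≤ ∑ i ∈ Finset.range (N + 1), n.choose i := by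
      refine Finset.card_biUnion_le.trans_eq ?_
      simp
    _ ≤ ∑ i ∈ Finset.range (N + 1), (n + 1) ^ N := by
      refine Finset.sum_le_sum fun i hi => ?_
      calc n.choose i ≤ n ^ i := Nat.choose_le_pow n i
        _ ≤ (n + 1) ^ i := Nat.pow_le_pow_left (Nat.le_succ n) i
        _ ≤ (n + 1) ^ N := Nat.pow_le_pow_right (Nat.succ_pos n)
          (Nat.lt_succ_iff.1 (Finset.mem_range.1 hi))
    _ = _ := by simp

open Classical in
-- Relative to a fixed splitting `I₀`, another splitting `I` is determined by `I₀ \ I` and `I \ I₀`.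
-- Each difference lies in the `A`-part of one splitting and the `B`-part of the other, so its
-- pattern is in `A ∩ B` and its size is at most `N`.
theorem card_splittings_le {A B : Set FinPerm} (hA : Hereditary A) (hB : Hereditary B) {N : ℕ}
    (hN : ∀ σ ∈ A ∩ B, σ.1 ≤ N) {n : ℕ} (π : Equiv.Perm (Fin n)) :
    (Finset.univ.filter fun I : Finset (Fin n) =>
      subPattern π I ∈ A ∧ subPattern π Iᶜ ∈ B).card ≤ ((N + 1) * (n + 1) ^ N) ^ 2 := by
  rcases (Finset.univ.filter fun I : Finset (Fin n) =>
      subPattern π I ∈ A ∧ subPattern π Iᶜ ∈ B).eq_empty_or_nonempty with h | ⟨I₀, h₀⟩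
  · rw [h]; exact Nat.zero_le _
  have h₀' := (Finset.mem_filter.1 h₀).2
  set P := Finset.univ.filter fun X : Finset (Fin n) => X.card ≤ N with hP
  have hdiff : ∀ I J : Finset (Fin n), subPattern π I ∈ A → subPattern π Jᶜ ∈ B → I \ J ∈ P :=
    fun I J hI hJ => Finset.mem_filter.2 ⟨Finset.mem_univ _, hN (subPattern π (I \ J))
      ⟨hA.subPattern_mem Finset.sdiff_subset hI, hB.subPattern_mem (fun x hx =>
        Finset.mem_compl.2 (Finset.mem_sdiff.1 hx).2) hJ⟩⟩
  calc _ ≤ (P ×ˢ P).card := by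
        refine Finset.card_le_card_of_injOn (fun I => (I₀ \ I, I \ I₀)) (fun I hI => ?_) ?_
        · have hI' := (Finset.mem_filter.1 (Finset.mem_coe.1 hI)).2
          exact Finset.mem_coe.2 (Finset.mem_product.2
            ⟨hdiff _ _ h₀'.1 hI'.2, hdiff _ _ hI'.1 h₀'.2⟩)
        · intro I _ J _ hIJ
          obtain ⟨h1, h2⟩ := Prod.ext_iff.1 hIJ
          ext x
          have e1 := Finset.ext_iff.1 h1 x
          have e2 := Finset.ext_iff.1 h2 x
          simp only [Finset.mem_sdiff] at e1 e2
          tauto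
    _ ≤ _ := by
      rw [Finset.card_product, sq]
      exact Nat.mul_le_mul (card_filter_card_le n N) (card_filter_card_le n N)

theorem le_count_merge {A B : Set FinPerm} (hA : Hereditary A) (hB : Hereditary B) {N : ℕ}
    (hN : ∀ σ ∈ A ∩ B, σ.1 ≤ N) (n : ℕ) :
    ∑ k ∈ Finset.range (n + 1), n.choose k * (n.choose k * (count A k * count B (n - k))) ≤
      count (merge A B) n * ((N + 1) * (n + 1) ^ N) ^ 2 := by
  classical
  rw [← sum_card_subPattern_mem_mem]
  have h1 : ∀ I : Finset (Fin n),
      Set.ncard {π : Equiv.Perm (Fin n) | subPattern π I ∈ A ∧ subPattern π Iᶜ ∈ B} =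
      ∑ π : Equiv.Perm (Fin n), if subPattern π I ∈ A ∧ subPattern π Iᶜ ∈ B then 1 else 0 :=
    fun I => by
      rw [Set.ncard_eq_toFinset_card', ← Finset.card_filter]
      congr 1
      ext; simp
  have h2 : count (merge A B) n =
      (Finset.univ.filter fun π : Equiv.Perm (Fin n) => (⟨n, π⟩ : FinPerm) ∈ merge A B).card := by
    rw [count, Set.ncard_eq_toFinset_card']
    congr 1
    ext; simp
  simp only [h1]
  rw [Finset.sum_comm, h2, Finset.card_eq_sum_ones, Finset.sum_mul, Finset.sum_filter]
  refine Finset.sum_le_sum fun π _ => ?_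
  rw [← Finset.card_filter]
  split_ifs with h
  · rw [one_mul]
    exact card_splittings_le hA hB hN π
  · rw [Nat.le_zero, Finset.card_eq_zero, Finset.filter_eq_empty_iff]
    exact fun I _ hI => h (mem_merge_iff.2 ⟨I, hI⟩)

theorem count_directSum_le (A B : Set FinPerm) (n : ℕ) : count (directSum A B) n ≤
    ∑ k ∈ Finset.range (n + 1), count A k * count B (n - k) := by
  set f : ∀ p : ℕ × ℕ, Equiv.Perm (Fin p.1) × Equiv.Perm (Fin p.2) → FinPerm :=
    fun p x => ⟨p.1 + p.2, permSum x.1 x.2⟩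
  set T : ∀ p : ℕ × ℕ, Set (Equiv.Perm (Fin p.1) × Equiv.Perm (Fin p.2)) := fun p =>
    {α | (⟨p.1, α⟩ : FinPerm) ∈ A} ×ˢ {β | (⟨p.2, β⟩ : FinPerm) ∈ B}
  calc count (directSum A B) n
      = (Sigma.mk (β := fun n => Equiv.Perm (Fin n)) n ''
          {π : Equiv.Perm (Fin n) | (⟨n, π⟩ : FinPerm) ∈ directSum A B}).ncard :=
        by rw [Set.ncard_image_of_injective _ sigma_mk_injective]; rfl
    _ ≤ (⋃ p ∈ Finset.HasAntidiagonal.antidiagonal n, f p '' T p).ncard := by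
      refine Set.ncard_le_ncard ?_ (Set.Finite.biUnion (Finset.finite_toSet _) fun p _ =>
        (Set.toFinite (T p)).image (f p))
      rintro _ ⟨π, ⟨α, hα, β, hβ, h⟩, rfl⟩
      refine Set.mem_biUnion (x := (α.1, β.1)) ?_ ⟨(α.2, β.2), ⟨hα, hβ⟩, h.symm⟩
      exact Finset.mem_coe.2 (Finset.HasAntidiagonal.mem_antidiagonal.2 (congrArg Sigma.fst h).symm)
    _ ≤ ∑ p ∈ Finset.HasAntidiagonal.antidiagonal n, (f p '' T p).ncard := Finset.set_ncard_biUnion_le _ _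
    _ ≤ ∑ p ∈ Finset.HasAntidiagonal.antidiagonal n, count A p.1 * count B p.2 := by
      refine Finset.sum_le_sum fun p _ => (Set.ncard_image_le (Set.toFinite _)).trans_eq ?_
      exact Set.ncard_prod
    _ = _ := Finset.Nat.sum_antidiagonal_eq_sum_range_succ (fun i j => count A i * count B j) n

/-! ### Growth rates of the constructions -/

/-- `s` is the growth rate of `A`, and `L_A(Π_n) / √n` has mean tending to `2 √s`. -/
structure HasRate (A : Set FinPerm) (s : ℝ) : Prop where
  nonneg : 0 ≤ s
  tendsto_count : Tendsto (fun n : ℕ => (count A n : ℝ) ^ (1 / (n : ℝ))) atTop (𝓝 s)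
  tendsto_mean : Tendsto (fun n : ℕ => meanLongest A n / √(n : ℝ)) atTop (𝓝 (2 * √s))

theorem SatisfiesConjecture.hasRate {A : Set FinPerm} (h : SatisfiesConjecture A) :
    HasRate A (sConst A) := by
  obtain ⟨h1, h2, h3⟩ := h
  refine ⟨?_, h1, h3 ▸ h2⟩
  rw [← h3]
  exact sq_nonneg _

theorem HasRate.sConst_eq {A : Set FinPerm} {s : ℝ} (h : HasRate A s) : sConst A = s :=
  h.tendsto_count.limsup_eq

theorem HasRate.cConst_eq {A : Set FinPerm} {s : ℝ} (h : HasRate A s) : cConst A = s := by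
  rw [cConst, h.tendsto_mean.limsup_eq, mul_div_cancel_left₀ _ two_ne_zero, Real.sq_sqrt h.nonneg]

theorem HasRate.satisfiesConjecture {A : Set FinPerm} {s : ℝ} (h : HasRate A s) :
    SatisfiesConjecture A := by
  refine ⟨?_, ?_, ?_⟩
  · rw [h.sConst_eq]; exact h.tendsto_count
  · rw [h.cConst_eq]; exact h.tendsto_mean
  · rw [h.sConst_eq, h.cConst_eq]

/-- Stated for any `U` between the two classes and their direct sum, so that it covers the union as
well. -/
theorem tendsto_count_of_le_directSum {A B U : Set FinPerm} (hA : IsPatternClass A)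
    (hB : IsPatternClass B) {a b : ℝ} (ha : HasRate A a) (hb : HasRate B b) (hAU : A ⊆ U)
    (hBU : B ⊆ U) (hU : U ⊆ directSum A B) :
    Tendsto (fun n : ℕ => (count U n : ℝ) ^ (1 / (n : ℝ))) atTop (𝓝 (max a b)) := by
  rw [isPatternClass_iff] at hA hB
  refine tendsto_root_of_bounds (fun n => Nat.cast_nonneg _) (fun t ht ht0 => ?_)
    (fun t ht0 ht => ?_) (ha.nonneg.trans (le_max_left a b))
  · obtain ⟨C, hC, h1⟩ := exists_forall_le_mul_pow (fun n => Nat.cast_nonneg _)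
      ha.tendsto_count ((le_max_left a b).trans_lt ht) ht0
    obtain ⟨D, hD, h2⟩ := exists_forall_le_mul_pow (fun n => Nat.cast_nonneg _)
      hb.tendsto_count ((le_max_right a b).trans_lt ht) ht0
    refine ⟨C * D, 1, fun n => ?_⟩
    calc (count U n : ℝ)
        ≤ ∑ k ∈ Finset.range (n + 1), (count A k : ℝ) * count B (n - k) := by
          exact_mod_cast (count_mono hU n).trans (count_directSum_le A B n)
      _ ≤ ∑ k ∈ Finset.range (n + 1), C * D * t ^ n := by
        refine Finset.sum_le_sum fun k hk => ?_
        calc (count A k : ℝ) * count B (n - k) ≤ (C * t ^ k) * (D * t ^ (n - k)) :=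
              mul_le_mul (h1 k) (h2 (n - k)) (Nat.cast_nonneg _) (by positivity)
          _ = C * D * t ^ (k + (n - k)) := by rw [pow_add]; ring
          _ = _ := by rw [Nat.add_sub_cancel' (Nat.lt_succ_iff.1 (Finset.mem_range.1 hk))]
      _ = _ := by
        simp only [Finset.sum_const, Finset.card_range, nsmul_eq_mul]
        push_cast
        ring
  · rcases lt_max_iff.1 ht with h | h
    · obtain ⟨δ, hδ, h1⟩ := hA.1.exists_forall_mul_pow_le hA.2 ha.tendsto_count ht0.le (.inl h)
      refine ⟨δ, 0, hδ, fun n => ?_⟩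
      rw [pow_zero, mul_one]
      exact (h1 n).trans (by exact_mod_cast count_mono hAU n)
    · obtain ⟨δ, hδ, h1⟩ := hB.1.exists_forall_mul_pow_le hB.2 hb.tendsto_count ht0.le (.inl h)
      refine ⟨δ, 0, hδ, fun n => ?_⟩
      rw [pow_zero, mul_one]
      exact (h1 n).trans (by exact_mod_cast count_mono hBU n)

/-- Scaling both rates by `θ < 1` lowers each of them strictly, except a rate that is zero; hence
the alternative in `Hereditary.exists_forall_mul_pow_le`. -/
theorem mul_lt_or_eq_zero {θ a : ℝ} (hθ : θ < 1) (ha : 0 ≤ a) : θ * a < a ∨ θ * a = 0 := by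
  rcases ha.eq_or_lt with rfl | ha
  · exact .inr (mul_zero _)
  · exact .inl (mul_lt_of_lt_one_left ha hθ)

theorem tendsto_count_juxt {A B : Set FinPerm} (hA : IsPatternClass A)
    (hB : IsPatternClass B) {a b : ℝ} (ha : HasRate A a) (hb : HasRate B b) :
    Tendsto (fun n : ℕ => (count (juxt A B) n : ℝ) ^ (1 / (n : ℝ))) atTop (𝓝 (a + b)) := by
  rw [isPatternClass_iff] at hA hB
  have ha0 := ha.nonneg
  have hb0 := hb.nonneg
  refine tendsto_root_of_bounds (fun n => Nat.cast_nonneg _) (fun t ht ht0 => ?_)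
    (fun t ht0 ht => ?_) (add_nonneg ha0 hb0)
  · set η := (t - (a + b)) / 2 with hη
    have hη0 : 0 < η := by rw [hη]; linarith
    obtain ⟨C, hC, h1⟩ := exists_forall_le_mul_pow (fun n => Nat.cast_nonneg _)
      ha.tendsto_count (lt_add_of_pos_right a hη0) (by positivity)
    obtain ⟨D, hD, h2⟩ := exists_forall_le_mul_pow (fun n => Nat.cast_nonneg _)
      hb.tendsto_count (lt_add_of_pos_right b hη0) (by positivity)
    refine ⟨C * D, 0, fun n => ?_⟩
    calc (count (juxt A B) n : ℝ)
        ≤ ∑ k ∈ Finset.range (n + 1), (n.choose k : ℝ) * (count A k * count B (n - k)) := by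
          exact_mod_cast count_juxt_le A B n
      _ ≤ ∑ k ∈ Finset.range (n + 1),
          (n.choose k : ℝ) * ((C * (a + η) ^ k) * (D * (b + η) ^ (n - k))) := by
        gcongr with k hk
        · exact h1 k
        · exact h2 (n - k)
      _ = C * D * ((a + η) + (b + η)) ^ n := by
        rw [add_pow, Finset.mul_sum]
        exact Finset.sum_congr rfl fun k _ => by ring
      _ = _ := by
        rw [pow_zero, mul_one]
        congr 2
        rw [hη]; ring
  -- With this `θ` the scaled rates `θ * a` and `θ * b` add up to exactly `t`.
  · set θ := t / (a + b) with hθ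
    have hs : 0 < a + b := ht0.trans ht
    have hθ1 : θ < 1 := (div_lt_one hs).2 ht
    have hθ0 : 0 < θ := div_pos ht0 hs
    obtain ⟨δ, hδ, h1⟩ := hA.1.exists_forall_mul_pow_le hA.2 ha.tendsto_count
      (by positivity) (mul_lt_or_eq_zero hθ1 ha0)
    obtain ⟨ε, hε, h2⟩ := hB.1.exists_forall_mul_pow_le hB.2 hb.tendsto_count
      (by positivity) (mul_lt_or_eq_zero hθ1 hb0)
    refine ⟨δ * ε, 1, by positivity, fun n => ?_⟩
    calc δ * ε * t ^ n = δ * ε * (θ * a + θ * b) ^ n := by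
          congr 2
          rw [hθ]; field_simp
      _ = ∑ k ∈ Finset.range (n + 1),
          (n.choose k : ℝ) * ((δ * (θ * a) ^ k) * (ε * (θ * b) ^ (n - k))) := by
        rw [add_pow, Finset.mul_sum]
        exact Finset.sum_congr rfl fun k _ => by ring
      _ ≤ ∑ k ∈ Finset.range (n + 1), (n.choose k : ℝ) * (count A k * count B (n - k)) := by
        gcongr with k hk
        · exact h1 k
        · exact h2 (n - k)
      _ ≤ ((n : ℝ) + 1) * count (juxt A B) n := by exact_mod_cast le_count_juxt A B n
      _ = _ := by ring

theorem sum_choose_sq_mul_pow_le {x y : ℝ} (hx : 0 ≤ x) (hy : 0 ≤ y) (n : ℕ) :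
    ∑ k ∈ Finset.range (n + 1),
      (n.choose k : ℝ) * (n.choose k * ((x ^ 2) ^ k * (y ^ 2) ^ (n - k))) ≤ ((x + y) ^ 2) ^ n := by
  calc _ = ∑ k ∈ Finset.range (n + 1), (x ^ k * y ^ (n - k) * n.choose k) ^ 2 :=
        Finset.sum_congr rfl fun k _ => by ring
    _ ≤ (∑ k ∈ Finset.range (n + 1), x ^ k * y ^ (n - k) * n.choose k) ^ 2 :=
        Finset.sum_sq_le_sq_sum_of_nonneg fun k _ => by positivity
    _ = _ := by rw [← add_pow, ← pow_mul, ← pow_mul, mul_comm]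

/-- Cauchy–Schwarz over the `n + 1` terms of the binomial expansion; the converse bound
`sum_choose_sq_mul_pow_le` needs nonnegative terms. -/
theorem le_sum_choose_sq_mul_pow (x y : ℝ) (n : ℕ) :
    ((x + y) ^ 2) ^ n ≤ (n + 1) * ∑ k ∈ Finset.range (n + 1),
      (n.choose k : ℝ) * (n.choose k * ((x ^ 2) ^ k * (y ^ 2) ^ (n - k))) := by
  calc ((x + y) ^ 2) ^ n
      = (∑ k ∈ Finset.range (n + 1), x ^ k * y ^ (n - k) * n.choose k) ^ 2 := by
        rw [← add_pow, ← pow_mul, ← pow_mul, mul_comm]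
    _ ≤ (Finset.range (n + 1)).card *
        ∑ k ∈ Finset.range (n + 1), (x ^ k * y ^ (n - k) * n.choose k) ^ 2 :=
      sq_sum_le_card_mul_sum_sq
    _ = _ := by
      rw [Finset.card_range]
      push_cast
      congr 1
      exact Finset.sum_congr rfl fun k _ => by ring

theorem tendsto_count_merge {A B : Set FinPerm} (hA : IsPatternClass A)
    (hB : IsPatternClass B) {a b : ℝ} (ha : HasRate A a) (hb : HasRate B b) {N : ℕ}
    (hN : ∀ σ ∈ A ∩ B, σ.1 ≤ N) :
    Tendsto (fun n : ℕ => (count (merge A B) n : ℝ) ^ (1 / (n : ℝ))) atTop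
      (𝓝 ((√a + √b) ^ 2)) := by
  rw [isPatternClass_iff] at hA hB
  have ha0 := ha.nonneg
  have hb0 := hb.nonneg
  refine tendsto_root_of_bounds (fun n => Nat.cast_nonneg _) (fun t ht ht0 => ?_)
    (fun t ht0 ht => ?_) (sq_nonneg _)
  · set η := (√t - (√a + √b)) / 2 with hη
    have hη0 : 0 < η := by
      have := Real.lt_sqrt_of_sq_lt ht
      rw [hη]; linarith
    have hlt : ∀ c : ℝ, 0 ≤ c → c < (√c + η) ^ 2 := fun c hc => by
      calc c = √c ^ 2 := (Real.sq_sqrt hc).symm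
        _ < _ := pow_lt_pow_left₀ (lt_add_of_pos_right _ hη0) (Real.sqrt_nonneg c) two_ne_zero
    obtain ⟨C, hC, h1⟩ := exists_forall_le_mul_pow (fun n => Nat.cast_nonneg _)
      ha.tendsto_count (hlt a ha0) (by positivity)
    obtain ⟨D, hD, h2⟩ := exists_forall_le_mul_pow (fun n => Nat.cast_nonneg _)
      hb.tendsto_count (hlt b hb0) (by positivity)
    refine ⟨C * D, 0, fun n => ?_⟩
    calc (count (merge A B) n : ℝ)
        ≤ ∑ k ∈ Finset.range (n + 1),
          (n.choose k : ℝ) * (n.choose k * (count A k * count B (n - k))) := by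
          exact_mod_cast count_merge_le A B n
      _ ≤ ∑ k ∈ Finset.range (n + 1), (n.choose k : ℝ) *
          (n.choose k * ((C * ((√a + η) ^ 2) ^ k) * (D * ((√b + η) ^ 2) ^ (n - k)))) := by
        gcongr with k hk
        · exact h1 k
        · exact h2 (n - k)
      _ = C * D * ∑ k ∈ Finset.range (n + 1), (n.choose k : ℝ) *
          (n.choose k * (((√a + η) ^ 2) ^ k * ((√b + η) ^ 2) ^ (n - k))) := by
        rw [Finset.mul_sum]
        exact Finset.sum_congr rfl fun k _ => by ring
      _ ≤ C * D * ((√a + η + (√b + η)) ^ 2) ^ n := by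
        gcongr
        exact sum_choose_sq_mul_pow_le (by positivity) (by positivity) n
      _ = _ := by
        rw [pow_zero, mul_one]
        congr 2
        rw [show √a + η + (√b + η) = √t by rw [hη]; ring, Real.sq_sqrt ht0.le]
  · set θ := t / (√a + √b) ^ 2 with hθ
    have hs : 0 < (√a + √b) ^ 2 := ht0.trans ht
    have hθ1 : θ < 1 := (div_lt_one hs).2 ht
    have hθ0 : 0 < θ := div_pos ht0 hs
    obtain ⟨δ, hδ, h1⟩ := hA.1.exists_forall_mul_pow_le hA.2 ha.tendsto_count
      (by positivity) (mul_lt_or_eq_zero hθ1 ha0)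
    obtain ⟨ε, hε, h2⟩ := hB.1.exists_forall_mul_pow_le hB.2 hb.tendsto_count
      (by positivity) (mul_lt_or_eq_zero hθ1 hb0)
    have hsq : ∀ c : ℝ, 0 ≤ c → (√(θ * c)) ^ 2 = θ * c := fun c hc =>
      Real.sq_sqrt (by positivity)
    have ht' : (√(θ * a) + √(θ * b)) ^ 2 = t := by
      rw [Real.sqrt_mul hθ0.le, Real.sqrt_mul hθ0.le, ← mul_add, mul_pow, Real.sq_sqrt hθ0.le,
        hθ, div_mul_cancel₀ _ hs.ne']
    -- One power of `n + 1` is the loss in Cauchy–Schwarz; the other `2 * N`, and the factor `(N +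
    -- 1) ^ 2`, come from the number of splittings of one permutation.
    refine ⟨δ * ε / (N + 1) ^ 2, 1 + 2 * N, by positivity, fun n => ?_⟩
    rw [div_mul_eq_mul_div, div_le_iff₀ (by positivity)]
    calc δ * ε * t ^ n = δ * ε * ((√(θ * a) + √(θ * b)) ^ 2) ^ n := by rw [ht']
      _ ≤ δ * ε * ((n + 1) * ∑ k ∈ Finset.range (n + 1), (n.choose k : ℝ) *
          (n.choose k * ((√(θ * a) ^ 2) ^ k * (√(θ * b) ^ 2) ^ (n - k)))) := by
        gcongr
        exact le_sum_choose_sq_mul_pow _ _ n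
      _ = (n + 1) * ∑ k ∈ Finset.range (n + 1), (n.choose k : ℝ) *
          (n.choose k * ((δ * (θ * a) ^ k) * (ε * (θ * b) ^ (n - k)))) := by
        rw [hsq a ha0, hsq b hb0, mul_left_comm, Finset.mul_sum]
        congr 1
        exact Finset.sum_congr rfl fun k _ => by ring
      _ ≤ (n + 1) * ∑ k ∈ Finset.range (n + 1),
          (n.choose k : ℝ) * (n.choose k * (count A k * count B (n - k))) := by
        gcongr with k hk
        · exact h1 k
        · exact h2 (n - k)
      _ ≤ (n + 1) * (count (merge A B) n * ((N + 1) * (n + 1) ^ N) ^ 2) := by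
        gcongr
        exact_mod_cast le_count_merge hA.1 hB.1 hN n
      _ = _ := by
        rw [mul_pow, ← pow_mul, pow_add, pow_one, mul_comm N 2]
        ring

/-! ### Mean lengths: generalities and merges -/

theorem meanLongest_eq (A : Set FinPerm) (n : ℕ) :
    ∑ π : Equiv.Perm (Fin n), (longest A π : ℝ) = n.factorial * meanLongest A n := by
  have : (0 : ℝ) < n.factorial := by exact_mod_cast Nat.factorial_pos n
  rw [meanLongest, mul_div_cancel₀ _ this.ne']

theorem meanLongest_le_iff {A : Set FinPerm} {n : ℕ} {x : ℝ} :
    meanLongest A n ≤ x ↔ ∑ π : Equiv.Perm (Fin n), (longest A π : ℝ) ≤ n.factorial * x := by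
  have : (0 : ℝ) < n.factorial := by exact_mod_cast Nat.factorial_pos n
  rw [meanLongest, div_le_iff₀' this]

theorem le_meanLongest_iff {A : Set FinPerm} {n : ℕ} {x : ℝ} :
    x ≤ meanLongest A n ↔ n.factorial * x ≤ ∑ π : Equiv.Perm (Fin n), (longest A π : ℝ) := by
  have : (0 : ℝ) < n.factorial := by exact_mod_cast Nat.factorial_pos n
  rw [meanLongest, le_div_iff₀' this]

theorem le_longest {A : Set FinPerm} {n : ℕ} {π : Equiv.Perm (Fin n)} {J : Finset (Fin n)}
    (h : subPattern π J ∈ A) : J.card ≤ longest A π := by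
  rw [longest_eq_longestIn]
  exact le_longestIn (Finset.subset_univ J) h

theorem exists_card_eq_longest {A : Set FinPerm} (h0 : (⟨0, 1⟩ : FinPerm) ∈ A) {n : ℕ}
    (π : Equiv.Perm (Fin n)) : ∃ J, subPattern π J ∈ A ∧ J.card = longest A π := by
  rw [longest_eq_longestIn]
  obtain ⟨J, -, h⟩ := exists_card_eq_longestIn h0 π Finset.univ
  exact ⟨J, h⟩

theorem meanLongest_mono {A B : Set FinPerm} (h0 : (⟨0, 1⟩ : FinPerm) ∈ A) (h : A ⊆ B) (n : ℕ) :
    meanLongest A n ≤ meanLongest B n := by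
  rw [meanLongest_le_iff, ← meanLongest_eq]
  refine Finset.sum_le_sum fun π _ => ?_
  obtain ⟨J, hJ, hc⟩ := exists_card_eq_longest h0 π
  rw [← hc]
  exact_mod_cast le_longest (h hJ)

theorem tendsto_div_sqrt_zero (C : ℝ) : Tendsto (fun n : ℕ => C / √(n : ℝ)) atTop (𝓝 0) :=
  (Real.tendsto_sqrt_atTop.comp tendsto_natCast_atTop_atTop).const_div_atTop C

theorem longest_merge_le {A B : Set FinPerm} (h0 : (⟨0, 1⟩ : FinPerm) ∈ merge A B) {n : ℕ}
    (π : Equiv.Perm (Fin n)) : longest (merge A B) π ≤ longest A π + longest B π := by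
  obtain ⟨J, hJ, hc⟩ := exists_card_eq_longest h0 π
  obtain ⟨I, h1, h2⟩ := subPattern_mem_merge.1 hJ
  rw [← hc, ← Finset.card_filter_add_card_filter_not (s := J) (· ∈ I)]
  exact Nat.add_le_add (le_longest h1) (le_longest h2)

/-- The union of an optimal set for `A` and one for `B` is a merge, and their overlap has pattern in
`A ∩ B`, hence at most `N` positions. -/
theorem le_longest_merge {A B : Set FinPerm} (hA : IsPatternClass A) (hB : IsPatternClass B)
    {N : ℕ} (hN : ∀ σ ∈ A ∩ B, σ.1 ≤ N) {n : ℕ} (π : Equiv.Perm (Fin n)) :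
    longest A π + longest B π ≤ longest (merge A B) π + N := by
  rw [isPatternClass_iff] at hA hB
  obtain ⟨J, hJ, hJc⟩ := exists_card_eq_longest hA.2 π
  obtain ⟨K, hK, hKc⟩ := exists_card_eq_longest hB.2 π
  have h1 : subPattern π (J ∪ K) ∈ merge A B := subPattern_mem_merge.2 ⟨J,
    hA.1.subPattern_mem (fun x hx => (Finset.mem_filter.1 hx).2) hJ,
    hB.1.subPattern_mem (fun x hx => (Finset.mem_union.1 (Finset.mem_filter.1 hx).1).resolve_left
      (Finset.mem_filter.1 hx).2) hK⟩
  have h2 : (J ∩ K).card ≤ N := hN (subPattern π (J ∩ K))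
    ⟨hA.1.subPattern_mem Finset.inter_subset_left hJ,
      hB.1.subPattern_mem Finset.inter_subset_right hK⟩
  have h3 := le_longest h1
  have h4 := Finset.card_union_add_card_inter J K
  omega

theorem hasRate_merge {A B : Set FinPerm} (hA : IsPatternClass A) (hB : IsPatternClass B)
    {a b : ℝ} (ha : HasRate A a) (hb : HasRate B b) (hfin : (A ∩ B).Finite) :
    HasRate (merge A B) ((√a + √b) ^ 2) := by
  obtain ⟨N, hN⟩ := (hfin.image Sigma.fst).bddAbove
  replace hN : ∀ σ ∈ A ∩ B, σ.1 ≤ N := fun σ hσ => hN (Set.mem_image_of_mem _ hσ)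
  refine ⟨sq_nonneg _, tendsto_count_merge hA hB ha hb hN, ?_⟩
  have hsum := ha.tendsto_mean.add hb.tendsto_mean
  rw [Real.sqrt_sq (by positivity), mul_add]
  have hlow := hsum.sub (tendsto_div_sqrt_zero N)
  rw [sub_zero] at hlow
  refine tendsto_of_tendsto_of_tendsto_of_le_of_le hlow hsum (fun n => ?_) fun n => ?_
  · simp only
    rw [← add_div, ← sub_div]
    refine div_le_div_of_nonneg_right ?_ (Real.sqrt_nonneg _)
    rw [le_meanLongest_iff, mul_sub, mul_add, ← meanLongest_eq, ← meanLongest_eq, sub_le_iff_le_add]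
    have : (n.factorial : ℝ) * N = ∑ π : Equiv.Perm (Fin n), (N : ℝ) := by
      simp [Fintype.card_perm]
    rw [this, ← Finset.sum_add_distrib, ← Finset.sum_add_distrib]
    refine Finset.sum_le_sum fun π _ => ?_
    exact_mod_cast le_longest_merge hA hB hN π
  · simp only
    rw [← add_div]
    refine div_le_div_of_nonneg_right ?_ (Real.sqrt_nonneg _)
    rw [meanLongest_le_iff, mul_add, ← meanLongest_eq, ← meanLongest_eq,
      ← Finset.sum_add_distrib]
    refine Finset.sum_le_sum fun π _ => ?_
    exact_mod_cast longest_merge_le (isPatternClass_iff.1 (isPatternClass_merge hA hB)).2 π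

/-! ### Upper bounds for means by a bounded number of boxes -/

/-- The constant `C` absorbs finitely many small `n`. A bound valid for every `n` is needed because
box sizes are random and may be small. -/
theorem exists_forall_abs_sub_le {u : ℕ → ℝ} {L : ℝ}
    (h : Tendsto (fun n : ℕ => u n / √(n : ℝ)) atTop (𝓝 L)) {ε : ℝ} (hε : 0 < ε) :
    ∃ C, 0 ≤ C ∧ ∀ n : ℕ, |u n - L * √(n : ℝ)| ≤ ε * √(n : ℝ) + C := by
  obtain ⟨N, hN⟩ := eventually_atTop.1
    ((h.eventually (Metric.ball_mem_nhds L hε)).and (eventually_gt_atTop 0))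
  refine ⟨∑ n ∈ Finset.range N, |u n - L * √(n : ℝ)|,
    Finset.sum_nonneg fun n _ => abs_nonneg _, fun n => ?_⟩
  rcases lt_or_ge n N with hn | hn
  · exact (Finset.single_le_sum (f := fun n : ℕ => |u n - L * √(n : ℝ)|)
      (fun n _ => abs_nonneg _) (Finset.mem_range.2 hn)).trans
      (le_add_of_nonneg_left (by positivity))
  · obtain ⟨h1, h2⟩ := hN n hn
    have h3 : 0 < √(n : ℝ) := Real.sqrt_pos.2 (by exact_mod_cast h2)
    replace h1 : |u n / √(n : ℝ) - L| < ε := h1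
    refine le_add_of_le_of_nonneg ?_ (Finset.sum_nonneg fun n _ => abs_nonneg _)
    calc |u n - L * √(n : ℝ)| = |u n / √(n : ℝ) - L| * √(n : ℝ) := by
          rw [← abs_of_pos h3, ← abs_mul, abs_of_pos h3, sub_mul, div_mul_cancel₀ _ h3.ne']
      _ ≤ _ := by gcongr

/-- The square of the deviation has order at most `√n * log n`, which is `o(n)`. -/
theorem tendsto_deviation {A : Set FinPerm} {s : ℝ} (h : HasRate A s) :
    Tendsto (fun n : ℕ => deviation A n / √(n : ℝ)) atTop (𝓝 0) := by
  have hlog : Tendsto (fun n : ℕ => Real.log n / √(n : ℝ)) atTop (𝓝 0) := by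
    have := (isLittleO_log_rpow_atTop (r := 1 / 2) (by norm_num)).tendsto_div_nhds_zero
    simp only [← Real.sqrt_eq_rpow] at this
    exact this.comp tendsto_natCast_atTop_atTop
  have hH0 : ∀ n : ℕ, (0 : ℝ) ≤ harmonic n := fun n => by
    rw [harmonic]; push_cast; positivity
  have hH : Tendsto (fun n : ℕ => (1 + (harmonic n : ℝ)) / √(n : ℝ)) atTop (𝓝 0) := by
    have h2 := (tendsto_div_sqrt_zero 2).add hlog
    rw [add_zero] at h2
    refine squeeze_zero (fun n => div_nonneg (by linarith [hH0 n]) (Real.sqrt_nonneg _))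
      (fun n => ?_) h2
    rw [← add_div]
    refine div_le_div_of_nonneg_right ?_ (Real.sqrt_nonneg _)
    linarith [harmonic_le_one_add_log n]
  have h3 := ((hH.mul h.tendsto_mean).const_mul 2).sqrt
  simp only [zero_mul, mul_zero, Real.sqrt_zero] at h3
  refine h3.congr fun n => ?_
  rw [deviation, ← Real.sqrt_div (mul_nonneg (by linarith [hH0 n]) (meanLongest_nonneg A n)),
    div_mul_div_comm, Real.mul_self_sqrt (Nat.cast_nonneg n), mul_div_assoc', mul_assoc]

/-- The good index `p` may depend on `π`. Replacing each length by its mean costs at most the sum of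
the absolute deviations over all of `P`, which no longer depends on the choice. -/
theorem sum_le_of_exists_box {A B : Set FinPerm} (hA : IsPatternClass A) (hB : IsPatternClass B)
    {n : ℕ} {ι : Type*} (P : Finset ι) (I V I' V' : ι → Finset (Fin n))
    {g : Equiv.Perm (Fin n) → ℝ}
    (hg : ∀ π, ∃ p ∈ P, g π ≤
      longestIn A π (box (I p) (V p) π) + longestIn B π (box (I' p) (V' p) π)) {M : ℝ}
    (hM : ∀ p ∈ P, ∑ π, (longestIn A π (box (I p) (V p) π) : ℝ) +
      ∑ π, (longestIn B π (box (I' p) (V' p) π) : ℝ) ≤ n.factorial * M) :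
    ∑ π, g π ≤ n.factorial * (M + P.card * (deviation A n + deviation B n)) := by
  rw [isPatternClass_iff] at hA hB
  have hN : (0 : ℝ) < n.factorial := by exact_mod_cast Nat.factorial_pos n
  set X : ι → Equiv.Perm (Fin n) → ℝ := fun p π => longestIn A π (box (I p) (V p) π) with hX
  set Y : ι → Equiv.Perm (Fin n) → ℝ := fun p π => longestIn B π (box (I' p) (V' p) π) with hY
  set DX : ι → Equiv.Perm (Fin n) → ℝ := fun p π => |X p π - (∑ τ, X p τ) / n.factorial|
  set DY : ι → Equiv.Perm (Fin n) → ℝ := fun p π => |Y p π - (∑ τ, Y p τ) / n.factorial|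
  have h1 : ∀ π, g π ≤ M + ∑ p ∈ P, (DX p π + DY p π) := fun π => by
    obtain ⟨p, hp, h⟩ := hg π
    have h2 : DX p π + DY p π ≤ ∑ p ∈ P, (DX p π + DY p π) :=
      Finset.single_le_sum (f := fun p => DX p π + DY p π)
        (fun p _ => add_nonneg (abs_nonneg _) (abs_nonneg _)) hp
    have h3 : (∑ τ, X p τ) / n.factorial + (∑ τ, Y p τ) / n.factorial ≤ M := by
      rw [← add_div, div_le_iff₀' hN]
      exact hM p hp
    have h4 : X p π - (∑ τ, X p τ) / n.factorial ≤ DX p π := le_abs_self _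
    have h5 : Y p π - (∑ τ, Y p τ) / n.factorial ≤ DY p π := le_abs_self _
    change g π ≤ X p π + Y p π at h
    linarith
  calc ∑ π, g π ≤ ∑ π, (M + ∑ p ∈ P, (DX p π + DY p π)) := Finset.sum_le_sum fun π _ => h1 π
    _ = n.factorial * M + ∑ p ∈ P, (∑ π, DX p π + ∑ π, DY p π) := by
      rw [Finset.sum_add_distrib, Finset.sum_comm]
      simp [Fintype.card_perm, Finset.sum_add_distrib]
    _ ≤ n.factorial * M + ∑ p ∈ P,
        (n.factorial * deviation A n + n.factorial * deviation B n) := by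
      gcongr with p hp
      · exact sum_abs_longestIn_box_sub_le hA.1 hA.2 (I p) (V p)
      · exact sum_abs_longestIn_box_sub_le hB.1 hB.2 (I' p) (V' p)
    _ = _ := by
      rw [Finset.sum_const, nsmul_eq_mul]
      ring

theorem eventually_div_sqrt_lt {u : ℕ → ℝ} {D : ℕ → ℝ}
    (hD : Tendsto (fun n : ℕ => D n / √(n : ℝ)) atTop (𝓝 0)) {L : ℝ} (hL : 0 ≤ L)
    (h : ∀ ε : ℝ, 0 < ε → ∀ K : ℕ, 0 < K → ∃ C c : ℝ, ∀ n : ℕ, 0 < n →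
      u n ≤ (L + ε) * ((1 + 1 / K) * √(n : ℝ) + (K + 1)) + C + c * D n) {x : ℝ} (hx : L < x) :
    ∀ᶠ n : ℕ in atTop, u n / √(n : ℝ) < x := by
  set ε := (x - L) / 2 with hε
  have hε0 : 0 < ε := by rw [hε]; linarith
  -- This `K` makes the discretisation error `(L + ε) / K` smaller than `ε`, while `L + 2 * ε = x`.
  obtain ⟨K, hK⟩ := exists_nat_gt ((L + ε) / ε)
  have hK0 : (0 : ℝ) < K := lt_of_le_of_lt (by positivity) hK
  obtain ⟨C, c, hC⟩ := h ε hε0 K (by exact_mod_cast hK0)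
  have h1 : (L + ε) * (1 + 1 / K) < x := by
    rw [div_lt_iff₀ hε0] at hK
    have : (L + ε) / K < ε := by rw [div_lt_iff₀ hK0]; linarith
    calc _ = L + ε + (L + ε) / K := by ring
      _ < L + ε + ε := by linarith
      _ = x := by rw [hε]; ring
  have h2 := ((tendsto_div_sqrt_zero ((L + ε) * (K + 1) + C)).add (hD.const_mul c)).const_add
    ((L + ε) * (1 + 1 / K))
  simp only [mul_zero, add_zero] at h2
  filter_upwards [h2.eventually_lt_const h1, eventually_gt_atTop 0] with n hn hn0
  have h3 : 0 < √(n : ℝ) := Real.sqrt_pos.2 (by exact_mod_cast hn0)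
  refine lt_of_le_of_lt ?_ hn
  rw [div_le_iff₀ h3]
  refine (hC n hn0).trans_eq ?_
  field_simp
  ring

theorem meanLongest_le {A : Set FinPerm} {s : ℝ} (h : HasRate A s) {ε : ℝ} (hε : 0 < ε) :
    ∃ C, ∀ k, meanLongest A k ≤ (2 * √s + ε) * √(k : ℝ) + C := by
  obtain ⟨C, -, hC⟩ := exists_forall_abs_sub_le h.tendsto_mean hε
  exact ⟨C, fun k => by linarith [le_abs_self (meanLongest A k - 2 * √s * √(k : ℝ)), hC k]⟩

section Grid

variable {n K : ℕ}

theorem lt_mul_div_add_one (hK : 0 < K) : n < K * (n / K + 1) := by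
  exact Nat.lt_mul_div_succ n hK

theorem cast_div_add_one_le : ((n / K + 1 : ℕ) : ℝ) ≤ n / K + 1 := by
  push_cast
  gcongr
  exact Nat.cast_div_le

theorem card_filter_lt_le (c : ℕ) :
    ((Finset.univ.filter fun i : Fin n => (i : ℕ) < c).card : ℝ) ≤ c := by
  rw [Fin.card_filter_val_lt]
  exact_mod_cast min_le_right n c

theorem card_filter_ge_le {p m : ℕ} (hp : p ≤ K) (hn : n ≤ K * m) :
    ((Finset.univ.filter fun i : Fin n => p * m ≤ (i : ℕ)).card : ℝ) ≤ (K - p) * m := by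
  rw [filter_le_val_eq_compl, Finset.card_compl, Fin.card_filter_val_lt, Fintype.card_fin]
  have h : n - min n (p * m) ≤ (K - p) * m := by
    rw [Nat.sub_mul]
    omega
  rw [← Nat.cast_sub hp]
  exact_mod_cast h

theorem mul_div_sqrt_le (hK : 0 < K) (hn : 0 < n) :
    ((n / K + 1 : ℕ) : ℝ) / √(n : ℝ) * (K + 1) ≤ (1 + 1 / K) * √(n : ℝ) + (K + 1) := by
  have hn' : (1 : ℝ) ≤ n := by exact_mod_cast hn
  have hK' : (0 : ℝ) < K := by exact_mod_cast hK
  have h1 : 1 ≤ √(n : ℝ) := Real.one_le_sqrt.2 hn'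
  have h2 : √(n : ℝ) * √(n : ℝ) = n := Real.mul_self_sqrt (by positivity)
  rw [div_mul_eq_mul_div, div_le_iff₀ (by positivity)]
  calc ((n / K + 1 : ℕ) : ℝ) * (K + 1) ≤ (n / K + 1) * (K + 1) := by
        gcongr
        exact cast_div_add_one_le
    _ = (1 + 1 / K) * n + (K + 1) := by field_simp
    _ ≤ (1 + 1 / K) * n + (K + 1) * √(n : ℝ) := by nlinarith
    _ = _ := by linear_combination -(1 + 1 / (K : ℝ)) * h2

theorem sqrt_mul_le (hK : 0 < K) :
    √((K + 1) * (n / K + 1 : ℕ)) ≤ (1 + 1 / K) * √(n : ℝ) + (K + 1) := by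
  have hK' : (0 : ℝ) < K := by exact_mod_cast hK
  have hn' : (0 : ℝ) ≤ n := Nat.cast_nonneg n
  have h1 : (1 : ℝ) ≤ 1 + 1 / K := by
    have : (0 : ℝ) < 1 / K := by positivity
    linarith
  refine Real.sqrt_le_iff.2 ⟨by positivity, ?_⟩
  calc (K + 1) * ((n / K + 1 : ℕ) : ℝ) ≤ (K + 1) * (n / K + 1) := by
        gcongr
        exact cast_div_add_one_le
    _ = (1 + 1 / K) * n + (K + 1) := by field_simp
    _ ≤ (1 + 1 / K) ^ 2 * n + (K + 1) ^ 2 := by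
      gcongr
      · nlinarith
      · nlinarith
    _ = ((1 + 1 / K) * √(n : ℝ)) ^ 2 + (K + 1) ^ 2 := by
      rw [mul_pow, Real.sq_sqrt hn']
    _ ≤ _ := by
      have h2 : 0 ≤ (1 + 1 / (K : ℝ)) * √(n : ℝ) := by positivity
      nlinarith

end Grid

/-! ### Mean lengths for unions and direct sums -/

/-- The thresholds in position and value are rounded up for the `A`-box and down for the `B`-box, so
both boxes only grow. The mesh `n / K + 1` makes `K` steps exceed `n`, whence indices below `K`
suffice. -/
theorem exists_longest_directSum_le {A B : Set FinPerm} (hA : IsPatternClass A)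
    (hB : IsPatternClass B) {n K : ℕ} (hK : 0 < K) (π : Equiv.Perm (Fin n)) :
    ∃ p ∈ Finset.range K ×ˢ Finset.range K, (longest (directSum A B) π : ℝ) ≤
      longestIn A π (box (Finset.univ.filter fun i : Fin n => (i : ℕ) < (p.1 + 1) * (n / K + 1))
        (Finset.univ.filter fun i : Fin n => (i : ℕ) < (p.2 + 1) * (n / K + 1)) π) +
      longestIn B π (box (Finset.univ.filter fun i : Fin n => p.1 * (n / K + 1) ≤ (i : ℕ))
        (Finset.univ.filter fun i : Fin n => p.2 * (n / K + 1) ≤ (i : ℕ)) π) := by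
  obtain ⟨J, hJ, hc⟩ := exists_card_eq_longest
    (isPatternClass_iff.1 (isPatternClass_directSum hA hB)).2 π
  obtain ⟨t, ht, u, hu, htu, h1, h2⟩ := subPattern_mem_directSum.1 hJ
  set m := n / K + 1 with hm
  have hm0 : 0 < m := Nat.succ_pos _
  have hlt : ∀ x ≤ n, x / m < K := fun x hx =>
    Nat.div_lt_of_lt_mul (by rw [mul_comm]; exact hx.trans_lt (lt_mul_div_add_one hK))
  have hdiv : ∀ x y, y < x → y < (x / m + 1) * m := fun x y h =>
    h.trans (by rw [mul_comm]; exact Nat.lt_mul_div_succ x hm0)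
  have hdiv' : ∀ x y, x ≤ y → x / m * m ≤ y := fun x y h => (Nat.div_mul_le_self x m).trans h
  refine ⟨(t / m, u / m), Finset.mem_product.2 ⟨Finset.mem_range.2 (hlt t ht),
    Finset.mem_range.2 (hlt u hu)⟩, ?_⟩
  have h3 : J.card = (J.filter fun i : Fin n => (i : ℕ) < t).card +
      (J.filter fun i : Fin n => t ≤ (i : ℕ)).card := by
    rw [← Finset.card_filter_add_card_filter_not (s := J) fun i : Fin n => (i : ℕ) < t]
    simp only [not_lt]
  rw [← hc, h3]
  push_cast
  refine add_le_add ?_ ?_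
  · refine Nat.cast_le.2 (le_longestIn (fun i hi => ?_) h1)
    obtain ⟨hiJ, hit⟩ := Finset.mem_filter.1 hi
    simp only [box, Finset.mem_filter, Finset.mem_univ, true_and]
    exact ⟨hdiv _ _ hit, hdiv _ _ ((htu i hiJ).1 hit)⟩
  · refine Nat.cast_le.2 (le_longestIn (fun i hi => ?_) h2)
    obtain ⟨hiJ, hit⟩ := Finset.mem_filter.1 hi
    simp only [box, Finset.mem_filter, Finset.mem_univ, true_and]
    exact ⟨hdiv' _ _ hit, hdiv' _ _ (not_lt.1 fun h => not_lt.2 hit ((htu i hiJ).2 h))⟩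

/-- The AM-GM inequality for a box of `X` by `Y` grid steps: the bound becomes linear in the sides,
so those of the two boxes can be added. -/
theorem sqrt_mul_div_le {x y X Y m N : ℝ} (hX : 0 ≤ X) (hY : 0 ≤ Y) (hy : 0 ≤ y)
    (hm : 0 ≤ m) (h1 : x ≤ X * m) (h2 : y ≤ Y * m) (hN : 0 < N) :
    √(x * y / N) ≤ m / √N * ((X + Y) / 2) := by
  have hN' : √N ^ 2 = N := Real.sq_sqrt hN.le
  refine Real.sqrt_le_iff.2 ⟨by positivity, ?_⟩
  calc x * y / N ≤ (X * m) * (Y * m) / N := by gcongr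
    _ = m ^ 2 / N * (X * Y) := by ring
    _ ≤ m ^ 2 / N * ((X + Y) / 2) ^ 2 := by
      gcongr
      nlinarith [sq_nonneg (X - Y)]
    _ = _ := by rw [mul_pow (m / √N), div_pow m, hN']

theorem meanLongest_directSum_le {A B : Set FinPerm} (hA : IsPatternClass A)
    (hB : IsPatternClass B) {r C C' : ℝ} (hr : 0 ≤ r)
    (h1 : ∀ k, meanLongest A k ≤ r * √(k : ℝ) + C) (h2 : ∀ k, meanLongest B k ≤ r * √(k : ℝ) + C')
    {n K : ℕ} (hK : 0 < K) (hn : 0 < n) :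
    meanLongest (directSum A B) n ≤ r * ((1 + 1 / K) * √(n : ℝ) + (K + 1)) + (C + C') +
      (K * K : ℕ) * (deviation A n + deviation B n) := by
  rw [meanLongest_le_iff]
  have hn' : (0 : ℝ) < n := by exact_mod_cast hn
  have := sum_le_of_exists_box (n := n) hA hB (Finset.range K ×ˢ Finset.range K) _ _ _ _
    (exists_longest_directSum_le hA hB hK) (M := r * ((1 + 1 / K) * √(n : ℝ) + (K + 1)) + (C + C'))
    fun p hp => ?_
  · simpa using this
  obtain ⟨hp1, hp2⟩ := Finset.mem_product.1 hp
  have hp1' : p.1 ≤ K := (Finset.mem_range.1 hp1).le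
  have hp2' : p.2 ≤ K := (Finset.mem_range.1 hp2).le
  have hp1'' : (p.1 : ℝ) ≤ K := by exact_mod_cast hp1'
  have hp2'' : (p.2 : ℝ) ≤ K := by exact_mod_cast hp2'
  have hnm : n ≤ K * (n / K + 1) := (lt_mul_div_add_one hK).le
  refine (add_le_add (sum_longestIn_box_le (isPatternClass_iff.1 hA).2 hr h1 hn _ _)
    (sum_longestIn_box_le (isPatternClass_iff.1 hB).2 hr h2 hn _ _)).trans ?_
  rw [← mul_add]
  refine mul_le_mul_of_nonneg_left ?_ (Nat.cast_nonneg _)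
  have e1 := sqrt_mul_div_le (X := p.1 + 1) (Y := p.2 + 1) (m := (n / K + 1 : ℕ))
    (by positivity) (by positivity) (Nat.cast_nonneg _) (Nat.cast_nonneg _)
    ((card_filter_lt_le (n := n) ((p.1 + 1) * (n / K + 1))).trans_eq (by push_cast; ring))
    ((card_filter_lt_le (n := n) ((p.2 + 1) * (n / K + 1))).trans_eq (by push_cast; ring)) hn'
  have e2 := sqrt_mul_div_le (X := K - p.1) (Y := K - p.2) (m := (n / K + 1 : ℕ))
    (sub_nonneg.2 hp1'') (sub_nonneg.2 hp2'') (Nat.cast_nonneg _)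
    (Nat.cast_nonneg _) (card_filter_ge_le hp1' hnm) (card_filter_ge_le hp2' hnm) hn'
  have e3 := mul_div_sqrt_le hK hn
  -- For every `p` the half side sums of the two boxes add up to `K + 1`, as the boxes overlap by
  -- one grid step in each direction.
  have e4 := mul_le_mul_of_nonneg_left ((add_le_add e1 e2).trans_eq (b := _)
    (c := ((n / K + 1 : ℕ) : ℝ) / √(n : ℝ) * (K + 1)) (by ring) |>.trans e3) hr
  linarith

theorem tendsto_mean_of_le_directSum {A B U : Set FinPerm} (hA : IsPatternClass A)
    (hB : IsPatternClass B) {a b : ℝ} (ha : HasRate A a) (hb : HasRate B b) (hAU : A ⊆ U)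
    (hBU : B ⊆ U) (hU : U ⊆ directSum A B) :
    Tendsto (fun n : ℕ => meanLongest U n / √(n : ℝ)) atTop (𝓝 (2 * √(max a b))) := by
  have hA0 := (isPatternClass_iff.1 hA).2
  have hB0 := (isPatternClass_iff.1 hB).2
  have hdiv : ∀ {u v : ℝ} (n : ℕ), u ≤ v → u / √(n : ℝ) ≤ v / √(n : ℝ) := fun n h =>
    div_le_div_of_nonneg_right h (Real.sqrt_nonneg _)
  refine tendsto_order.2 ⟨fun x hx => ?_, fun x hx => ?_⟩
  · rcases le_total a b with hab | hab
    · rw [max_eq_right hab] at hx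
      filter_upwards [hb.tendsto_mean.eventually_const_lt hx] with n hn
      exact hn.trans_le (hdiv n (meanLongest_mono hB0 hBU n))
    · rw [max_eq_left hab] at hx
      filter_upwards [ha.tendsto_mean.eventually_const_lt hx] with n hn
      exact hn.trans_le (hdiv n (meanLongest_mono hA0 hAU n))
  · refine eventually_div_sqrt_lt (D := fun n => deviation A n + deviation B n) ?_
      (L := 2 * √(max a b)) (by positivity) (fun ε hε K hK => ?_) hx
    · simpa only [add_div, add_zero] using (tendsto_deviation ha).add (tendsto_deviation hb)
    · obtain ⟨C, hC⟩ := meanLongest_le ha hε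
      obtain ⟨C', hC'⟩ := meanLongest_le hb hε
      refine ⟨C + C', (K * K : ℕ), fun n hn => (meanLongest_mono (hAU hA0) hU n).trans
        (meanLongest_directSum_le hA hB (by positivity) (fun k => (hC k).trans ?_)
          (fun k => (hC' k).trans ?_) hK hn)⟩
      · gcongr
        exact le_max_left a b
      · gcongr
        exact le_max_right a b

theorem hasRate_of_le_directSum {A B U : Set FinPerm} (hA : IsPatternClass A)
    (hB : IsPatternClass B) {a b : ℝ} (ha : HasRate A a) (hb : HasRate B b) (hAU : A ⊆ U)
    (hBU : B ⊆ U) (hU : U ⊆ directSum A B) : HasRate U (max a b) :=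
  ⟨ha.nonneg.trans (le_max_left a b), tendsto_count_of_le_directSum hA hB ha hb hAU hBU hU,
    tendsto_mean_of_le_directSum hA hB ha hb hAU hBU hU⟩

/-! ### Mean lengths for juxtapositions -/

theorem box_univ {n : ℕ} (I : Finset (Fin n)) (π : Equiv.Perm (Fin n)) :
    box I Finset.univ π = I := by
  simp [box]

theorem exists_longest_juxt_le {A B : Set FinPerm} (hA : IsPatternClass A)
    (hB : IsPatternClass B) {n K : ℕ} (hK : 0 < K) (π : Equiv.Perm (Fin n)) :
    ∃ p ∈ Finset.range K, (longest (juxt A B) π : ℝ) ≤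
      longestIn A π (box (Finset.univ.filter fun i : Fin n => (i : ℕ) < (p + 1) * (n / K + 1))
        Finset.univ π) +
      longestIn B π (box (Finset.univ.filter fun i : Fin n => p * (n / K + 1) ≤ (i : ℕ))
        Finset.univ π) := by
  obtain ⟨J, hJ, hc⟩ := exists_card_eq_longest
    (isPatternClass_iff.1 (isPatternClass_juxt hA hB)).2 π
  obtain ⟨t, ht, h1, h2⟩ := subPattern_mem_juxt.1 hJ
  set m := n / K + 1 with hm
  have hm0 : 0 < m := Nat.succ_pos _
  refine ⟨t / m, Finset.mem_range.2 (Nat.div_lt_of_lt_mul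
    (by rw [mul_comm]; exact ht.trans_lt (lt_mul_div_add_one hK))), ?_⟩
  have h3 : J.card = (J.filter fun i : Fin n => (i : ℕ) < t).card +
      (J.filter fun i : Fin n => t ≤ (i : ℕ)).card := by
    rw [← Finset.card_filter_add_card_filter_not (s := J) fun i : Fin n => (i : ℕ) < t]
    simp only [not_lt]
  rw [← hc, h3, box_univ, box_univ]
  push_cast
  refine add_le_add ?_ ?_
  · refine Nat.cast_le.2 (le_longestIn (fun i hi => ?_) h1)
    refine Finset.mem_filter.2 ⟨Finset.mem_univ _, (Finset.mem_filter.1 hi).2.trans ?_⟩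
    rw [mul_comm]
    exact Nat.lt_mul_div_succ t hm0
  · refine Nat.cast_le.2 (le_longestIn (fun i hi => ?_) h2)
    exact Finset.mem_filter.2 ⟨Finset.mem_univ _,
      (Nat.div_mul_le_self t m).trans (Finset.mem_filter.1 hi).2⟩

theorem sqrt_mul_add_sqrt_mul_le {a b x y : ℝ} (ha : 0 ≤ a) (hb : 0 ≤ b) (hx : 0 ≤ x)
    (hy : 0 ≤ y) : √a * √x + √b * √y ≤ √(a + b) * √(x + y) := by
  rw [← Real.sqrt_mul (add_nonneg ha hb)]
  refine Real.le_sqrt_of_sq_le ?_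
  have h1 := Real.sq_sqrt ha
  have h2 := Real.sq_sqrt hb
  have h3 := Real.sq_sqrt hx
  have h4 := Real.sq_sqrt hy
  calc (√a * √x + √b * √y) ^ 2
      ≤ (√a ^ 2 + √b ^ 2) * (√x ^ 2 + √y ^ 2) := by
        nlinarith [sq_nonneg (√a * √y - √b * √x)]
    _ = _ := by rw [h1, h2, h3, h4]

/-- For a cut into `x` and `y` positions the mean is about `2 * (√a * √x + √b * √y)`, which
Cauchy–Schwarz bounds by `2 * √(a + b) * √(x + y)` wherever the cut falls; rounding makes `x + y`
exceed `n` only by the order of `n / K`. -/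
theorem meanLongest_juxt_le {A B : Set FinPerm} (hA : IsPatternClass A)
    (hB : IsPatternClass B) {a b ε C C' : ℝ} (ha : 0 ≤ a) (hb : 0 ≤ b) (hε : 0 ≤ ε)
    (h1 : ∀ k, meanLongest A k ≤ (2 * √a + ε / 2) * √(k : ℝ) + C)
    (h2 : ∀ k, meanLongest B k ≤ (2 * √b + ε / 2) * √(k : ℝ) + C')
    {n K : ℕ} (hK : 0 < K) (hn : 0 < n) :
    meanLongest (juxt A B) n ≤
      (2 * √(a + b) + ε) * ((1 + 1 / K) * √(n : ℝ) + (K + 1)) + (C + C') +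
        K * (deviation A n + deviation B n) := by
  rw [meanLongest_le_iff]
  have hn' : (0 : ℝ) < n := by exact_mod_cast hn
  have := sum_le_of_exists_box (n := n) hA hB (Finset.range K) _ _ _ _
    (exists_longest_juxt_le hA hB hK)
    (M := (2 * √(a + b) + ε) * ((1 + 1 / K) * √(n : ℝ) + (K + 1)) + (C + C')) fun p hp => ?_
  · simpa using this
  have hp1 : p ≤ K := (Finset.mem_range.1 hp).le
  have hp2 : (0 : ℝ) ≤ K - p := sub_nonneg.2 (by exact_mod_cast hp1)
  have hnm : n ≤ K * (n / K + 1) := (lt_mul_div_add_one hK).le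
  refine (add_le_add
    (sum_longestIn_box_le (isPatternClass_iff.1 hA).2 (by positivity) h1 hn _ _)
    (sum_longestIn_box_le (isPatternClass_iff.1 hB).2 (by positivity) h2 hn _ _)).trans ?_
  rw [← mul_add]
  refine mul_le_mul_of_nonneg_left ?_ (Nat.cast_nonneg _)
  simp only [Finset.card_univ, Fintype.card_fin, mul_div_cancel_right₀ _ hn'.ne']
  have e1 := Real.sqrt_le_sqrt
    ((card_filter_lt_le (n := n) ((p + 1) * (n / K + 1))).trans_eq
      (c := ((p : ℝ) + 1) * (n / K + 1 : ℕ)) (by push_cast; rfl))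
  have e2 := Real.sqrt_le_sqrt (card_filter_ge_le hp1 hnm)
  set x : ℝ := (p + 1) * (n / K + 1 : ℕ) with hx
  set y : ℝ := (K - p) * (n / K + 1 : ℕ) with hy
  have hx0 : 0 ≤ x := by positivity
  have hy0 : 0 ≤ y := by positivity
  have hxy : x + y = (K + 1) * (n / K + 1 : ℕ) := by rw [hx, hy]; ring
  have e3 : √(x + y) ≤ (1 + 1 / K) * √(n : ℝ) + (K + 1) := by
    rw [hxy]; exact sqrt_mul_le hK
  have e4 := sqrt_mul_add_sqrt_mul_le ha hb hx0 hy0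
  have e5 : √x ≤ √(x + y) := Real.sqrt_le_sqrt (by linarith)
  have e6 : √y ≤ √(x + y) := Real.sqrt_le_sqrt (by linarith)
  have e7 := mul_le_mul_of_nonneg_left e1 (by positivity : 0 ≤ 2 * √a + ε / 2)
  have e8 := mul_le_mul_of_nonneg_left e2 (by positivity : 0 ≤ 2 * √b + ε / 2)
  have e9 := mul_le_mul_of_nonneg_left e3 (by positivity : 0 ≤ 2 * √(a + b) + ε)
  have e10 := mul_le_mul_of_nonneg_left (add_le_add e5 e6) hε
  have e11 : (2 * √a + ε / 2) * √x + (2 * √b + ε / 2) * √y ≤ (2 * √(a + b) + ε) * √(x + y) := by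
    linarith
  linarith

/-- With the cut fixed in advance no concentration is needed: the patterns on both blocks are
uniform, and expectations add. -/
theorem add_meanLongest_le_juxt {A B : Set FinPerm} (hA : IsPatternClass A)
    (hB : IsPatternClass B) {n k : ℕ} (hk : k ≤ n) :
    meanLongest A k + meanLongest B (n - k) ≤ meanLongest (juxt A B) n := by
  rw [isPatternClass_iff] at hA hB
  have h1 := sum_longestIn hA.2 (Finset.univ.filter fun i : Fin n => (i : ℕ) < k)
  have h2 := sum_longestIn hB.2 (Finset.univ.filter fun i : Fin n => k ≤ (i : ℕ))
  rw [card_filter_val_lt hk] at h1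
  rw [show (Finset.univ.filter fun i : Fin n => k ≤ (i : ℕ)).card = n - k by
    rw [filter_le_val_eq_compl, Finset.card_compl, card_filter_val_lt hk, Fintype.card_fin]] at h2
  rw [le_meanLongest_iff, mul_add, ← h1, ← h2, ← Finset.sum_add_distrib]
  refine Finset.sum_le_sum fun π _ => ?_
  obtain ⟨J, hJ, hJA, hJc⟩ :=
    exists_card_eq_longestIn hA.2 π (Finset.univ.filter fun i : Fin n => (i : ℕ) < k)
  obtain ⟨J', hJ', hJB, hJc'⟩ :=
    exists_card_eq_longestIn hB.2 π (Finset.univ.filter fun i : Fin n => k ≤ (i : ℕ))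
  have m1 : ∀ i ∈ J, (i : ℕ) < k := fun i hi => (Finset.mem_filter.1 (hJ hi)).2
  have m2 : ∀ i ∈ J', k ≤ (i : ℕ) := fun i hi => (Finset.mem_filter.1 (hJ' hi)).2
  have hdis : Disjoint J J' := Finset.disjoint_left.2 fun i hi hi' =>
    absurd (m1 i hi) (not_lt.2 (m2 i hi'))
  rw [← hJc, ← hJc', ← Nat.cast_add, ← Finset.card_union_of_disjoint hdis, Nat.cast_le]
  refine le_longest (subPattern_mem_juxt.2 ⟨k, hk, hA.1.subPattern_mem (fun i hi => ?_) hJA,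
    hB.1.subPattern_mem (fun i hi => ?_) hJB⟩)
  · obtain ⟨hi, hik⟩ := Finset.mem_filter.1 hi
    exact (Finset.mem_union.1 hi).resolve_right fun h => absurd hik (not_lt.2 (m2 i h))
  · obtain ⟨hi, hik⟩ := Finset.mem_filter.1 hi
    exact (Finset.mem_union.1 hi).resolve_left fun h => absurd hik (not_le.2 (m1 i h))

theorem le_meanLongest_juxt {A B : Set FinPerm} (hA : IsPatternClass A)
    (hB : IsPatternClass B) {a b : ℝ} (ha : HasRate A a) (hb : HasRate B b) {ε : ℝ} (hε : 0 < ε) :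
    ∃ C, ∀ n : ℕ, (2 * √(a + b) - ε) * √(n : ℝ) - C ≤ meanLongest (juxt A B) n := by
  have ha0 := ha.nonneg
  have hb0 := hb.nonneg
  rcases (add_nonneg ha0 hb0).eq_or_lt with hab | hab
  · refine ⟨0, fun n => ?_⟩
    rw [← hab, Real.sqrt_zero]
    have := mul_nonneg hε.le (Real.sqrt_nonneg (n : ℝ))
    linarith [meanLongest_nonneg (juxt A B) n]
  obtain ⟨C, -, h1⟩ := exists_forall_abs_sub_le ha.tendsto_mean (half_pos hε)
  obtain ⟨C', -, h2⟩ := exists_forall_abs_sub_le hb.tendsto_mean (half_pos hε)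
  -- The term `2 * √a` pays for rounding the cut down to an integer.
  refine ⟨C + C' + 2 * √a, fun n => ?_⟩
  -- The proportion for which Cauchy–Schwarz is an equality: `√a * √x + √b * √(1 - x) = √(a + b)`.
  set x := a / (a + b) with hx
  have hx0 : 0 ≤ x := by positivity
  have hx1 : x ≤ 1 := (div_le_one hab).2 (by linarith)
  have hx1' : 1 - x = b / (a + b) := by rw [hx]; field_simp; ring
  set k := ⌊x * n⌋₊ with hk
  have hxn : 0 ≤ x * n := by positivity
  have hkx : (k : ℝ) ≤ x * n := Nat.floor_le hxn
  have hkx' : x * n < k + 1 := Nat.lt_floor_add_one _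
  have hkn : k ≤ n := by
    have : (k : ℝ) ≤ n := hkx.trans (mul_le_of_le_one_left (Nat.cast_nonneg n) hx1)
    exact_mod_cast this
  have h3 := add_meanLongest_le_juxt hA hB hkn
  have h4 := (abs_le.1 (h1 k)).1
  have h5 := (abs_le.1 (h2 (n - k))).1
  have e1 : √(k : ℝ) ≤ √(n : ℝ) := Real.sqrt_le_sqrt (by exact_mod_cast hkn)
  have e2 : √((n - k : ℕ) : ℝ) ≤ √(n : ℝ) := Real.sqrt_le_sqrt (by exact_mod_cast Nat.sub_le n k)
  have e3 : √x * √(n : ℝ) ≤ √(k : ℝ) + 1 := by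
    rw [← Real.sqrt_mul hx0]
    refine Real.sqrt_le_iff.2 ⟨by positivity, ?_⟩
    have := Real.sq_sqrt (Nat.cast_nonneg (α := ℝ) k)
    nlinarith [Real.sqrt_nonneg (k : ℝ)]
  have e4 : √(1 - x) * √(n : ℝ) ≤ √((n - k : ℕ) : ℝ) := by
    rw [← Real.sqrt_mul (sub_nonneg.2 hx1), Nat.cast_sub hkn]
    exact Real.sqrt_le_sqrt (by linarith)
  have e5 : √a * √x + √b * √(1 - x) = √(a + b) := by
    have hs : 0 < √(a + b) := Real.sqrt_pos.2 hab
    rw [hx1', hx, Real.sqrt_div ha0, Real.sqrt_div hb0, mul_div_assoc', mul_div_assoc',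
      Real.mul_self_sqrt ha0, Real.mul_self_sqrt hb0, ← add_div, div_eq_iff hs.ne',
      Real.mul_self_sqrt hab.le]
  have e6 := mul_le_mul_of_nonneg_left e3 (Real.sqrt_nonneg a)
  have e7 := mul_le_mul_of_nonneg_left e4 (Real.sqrt_nonneg b)
  have e8 : √(a + b) * √(n : ℝ) ≤ √a * √(k : ℝ) + √a + √b * √((n - k : ℕ) : ℝ) := by
    rw [← e5]; linarith
  have e9 := mul_le_mul_of_nonneg_left (add_le_add e1 e2) (half_pos hε).le
  linarith

theorem hasRate_juxt {A B : Set FinPerm} (hA : IsPatternClass A) (hB : IsPatternClass B)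
    {a b : ℝ} (ha : HasRate A a) (hb : HasRate B b) : HasRate (juxt A B) (a + b) := by
  refine ⟨add_nonneg ha.nonneg hb.nonneg, tendsto_count_juxt hA hB ha hb,
    tendsto_order.2 ⟨fun x hx => ?_, fun x hx => ?_⟩⟩
  · set ε := (2 * √(a + b) - x) / 2 with hε
    obtain ⟨C, hC⟩ := le_meanLongest_juxt hA hB ha hb (ε := ε) (by rw [hε]; linarith)
    have h1 := (tendsto_div_sqrt_zero C).const_sub (2 * √(a + b) - ε)
    rw [sub_zero] at h1
    filter_upwards [h1.eventually_const_lt (u := x) (by rw [hε]; linarith),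
      eventually_gt_atTop 0] with n hn hn0
    have h3 : 0 < √(n : ℝ) := Real.sqrt_pos.2 (by exact_mod_cast hn0)
    refine hn.trans_le ?_
    rw [le_div_iff₀ h3, sub_mul, div_mul_cancel₀ _ h3.ne']
    exact hC n
  · refine eventually_div_sqrt_lt (D := fun n => deviation A n + deviation B n) ?_
      (L := 2 * √(a + b)) (by positivity) (fun ε hε K hK => ?_) hx
    · simpa only [add_div, add_zero] using (tendsto_deviation ha).add (tendsto_deviation hb)
    · obtain ⟨C, hC⟩ := meanLongest_le ha (half_pos hε)
      obtain ⟨C', hC'⟩ := meanLongest_le hb (half_pos hε)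
      exact ⟨C + C', K, fun n hn =>
        meanLongest_juxt_le hA hB ha.nonneg hb.nonneg hε.le hC hC' hK hn⟩

end PermClass

/-! ### The proposition -/

theorem mainTheorem4 (A B : Set PermClass.FinPerm)
    (hA : PermClass.IsPatternClass A) (hB : PermClass.IsPatternClass B)
    (hcA : PermClass.SatisfiesConjecture A) (hcB : PermClass.SatisfiesConjecture B) :
    (PermClass.IsPatternClass (A ∪ B) ∧
      PermClass.SatisfiesConjecture (A ∪ B) ∧
      PermClass.cConst (A ∪ B) = max (PermClass.cConst A) (PermClass.cConst B) ∧
      PermClass.sConst (A ∪ B) = max (PermClass.sConst A) (PermClass.sConst B)) ∧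
    (PermClass.IsPatternClass (PermClass.directSum A B) ∧
      PermClass.SatisfiesConjecture (PermClass.directSum A B) ∧
      PermClass.cConst (PermClass.directSum A B) =
        max (PermClass.cConst A) (PermClass.cConst B) ∧
      PermClass.sConst (PermClass.directSum A B) =
        max (PermClass.sConst A) (PermClass.sConst B)) ∧
    (PermClass.IsPatternClass (PermClass.juxt A B) ∧
      PermClass.SatisfiesConjecture (PermClass.juxt A B) ∧
      PermClass.cConst (PermClass.juxt A B) = PermClass.cConst A + PermClass.cConst B ∧
      PermClass.sConst (PermClass.juxt A B) = PermClass.sConst A + PermClass.sConst B) ∧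
    ((A ∩ B).Finite →
      PermClass.IsPatternClass (PermClass.merge A B) ∧
      PermClass.SatisfiesConjecture (PermClass.merge A B) ∧
      √(PermClass.cConst (PermClass.merge A B)) =
        √(PermClass.cConst A) + √(PermClass.cConst B) ∧
      √(PermClass.sConst (PermClass.merge A B)) =
        √(PermClass.sConst A) + √(PermClass.sConst B)) := by
  have ha := hcA.hasRate
  have hb := hcB.hasRate
  have hA0 := (PermClass.isPatternClass_iff.1 hA).2
  have hB0 := (PermClass.isPatternClass_iff.1 hB).2
  have hU := PermClass.hasRate_of_le_directSum hA hB ha hb Set.subset_union_left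
    Set.subset_union_right (Set.union_subset (PermClass.subset_directSum_left hB0)
      (PermClass.subset_directSum_right hA0))
  have hD := PermClass.hasRate_of_le_directSum hA hB ha hb (PermClass.subset_directSum_left hB0)
    (PermClass.subset_directSum_right hA0) subset_rfl
  have hJ := PermClass.hasRate_juxt hA hB ha hb
  refine ⟨⟨PermClass.isPatternClass_union hA hB, hU.satisfiesConjecture, ?_, hU.sConst_eq⟩,
    ⟨PermClass.isPatternClass_directSum hA hB, hD.satisfiesConjecture, ?_, hD.sConst_eq⟩,
    ⟨PermClass.isPatternClass_juxt hA hB, hJ.satisfiesConjecture, ?_, hJ.sConst_eq⟩,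
    fun hfin => ?_⟩
  · rw [hU.cConst_eq, ha.cConst_eq, hb.cConst_eq]
  · rw [hD.cConst_eq, ha.cConst_eq, hb.cConst_eq]
  · rw [hJ.cConst_eq, ha.cConst_eq, hb.cConst_eq]
  · have hM := PermClass.hasRate_merge hA hB ha hb hfin
    have hs := Real.sqrt_sq (add_nonneg (Real.sqrt_nonneg (PermClass.sConst A))
      (Real.sqrt_nonneg (PermClass.sConst B)))
    refine ⟨PermClass.isPatternClass_merge hA hB, hM.satisfiesConjecture, ?_, ?_⟩
    · rw [hM.cConst_eq, ha.cConst_eq, hb.cConst_eq, hs]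
    · rw [hM.sConst_eq, hs]
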